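/- Let $\mathbb{S}^1=\mathbb{R}/2\pi\mathbb{Z}$ and, for $s\ge 0$, let $H^s=H^s(\mathbb{S}^1)$ be the space of real valued $f\in L^2(\mathbb{S}^1)$ with $\|f\|_{H^s}^2=\sum_{k\in\mathbb{Z}}(1+k^2)^s|\hat f(k)|^2<\infty$. Let $r,q\in\mathbb{R}$ with $r\ge 2$ and $q\ge r+1$. Let $A$ be a symmetric Fourier multiplier of order $r$ on real valued functions that is invertible with inverse of order $-r$, i.e. $\widehat{Af}(k)=a(k)\hat f(k)$, where $a:\mathbb{Z}\to\mathbb{R}$ is even, $a(k)\neq 0$ for all $k$, $a(k)=\mathcal{O}((1+k^2)^{r/2})$ and $1/a(k)=\mathcal{O}((1+k^2)^{-r/2})$. Let $J\subseteq\mathbb{R}$ be an open interval and let $$u\in C^0(J,H^q)\cap C^1(J,H^{q-1})$$ be a solution on $J$ of the Euler equation $$u_t=-A^{-1}\left[u\,(Au)_x+2(Au)\,u_x\right].$$ Let $I\subseteq J$ be a bounded interval that is bounded below by some point $t_0\in J$ (for example $I\subseteq J\cap[t_0,\infty)$, where $t_0\in J$ is the initial time). If $$\inf_{t\in I}\ \min_{x\in\mathbb{S}^1}u_x(t,x)>-\infty,$$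 then $\|u(t)\|_{H^q}$ is bounded on $I$. -/

import Mathlib

open MeasureTheory
open scoped Real

noncomputable section

namespace EulerCircle

instance instTwoPiPos : Fact ((0 : ℝ) < 2 * π) := ⟨Real.two_pi_pos⟩

/-- The circle `ℝ / 2πℤ`. -/
abbrev S1 : Type := AddCircle (2 * π)

/-- Real valued `L²` functions (modulo equality a.e.) on the circle, for the normalized
Haar measure. -/
abbrev L2 : Type := Lp ℝ 2 (AddCircle.haarAddCircle (T := 2 * π))

/-- The `k`-th Fourier coefficient `(1 / 2π) ∫ f(x) exp(-ikx) dx` of a real valued function. -/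
def fhat (f : S1 → ℝ) (k : ℤ) : ℂ := fourierCoeff (fun x => (f x : ℂ)) k

/-- The `k`-th Fourier coefficient depends linearly on `f ∈ L²`. -/
theorem fhat_eq (f : L2) (k : ℤ) :
    fhat f k = fourierBasis.repr (Complex.ofRealCLM.compLpL 2 _ f) k := by
  rw [fourierBasis_repr]
  refine congrFun (fourierCoeff_congr_ae ?_) k
  filter_upwards [Complex.ofRealCLM.coeFn_compLpL (p := 2) f] with x hx
  exact hx.symm

theorem fhat_add (f g : L2) (k : ℤ) : fhat (f + g : L2) k = fhat f k + fhat g k := by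
  simp only [fhat_eq, map_add]; rfl

theorem fhat_smul (c : ℝ) (f : L2) (k : ℤ) : fhat (c • f : L2) k = c * fhat f k := by
  have h : Complex.ofRealCLM.compLpL 2 (AddCircle.haarAddCircle (T := 2 * π)) (c • f)
      = (c : ℂ) • Complex.ofRealCLM.compLpL 2 (AddCircle.haarAddCircle (T := 2 * π)) f := by
    rw [map_smul]
    refine Lp.ext ?_
    filter_upwards [Lp.coeFn_smul c (Complex.ofRealCLM.compLpL 2 _ f),
      Lp.coeFn_smul (c : ℂ) (Complex.ofRealCLM.compLpL 2 _ f)] with x h1 h2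
    rw [h1, h2]; simp
  simp only [fhat_eq]
  rw [h, map_smul]; rfl

theorem fhat_zero (k : ℤ) : fhat (0 : L2) k = 0 := by
  simp only [fhat_eq, map_zero]; rfl

/-- An `L²` function is determined by its Fourier coefficients. -/
theorem fhat_injective {f g : L2} (h : ∀ k, fhat f k = fhat g k) : f = g := by
  have h1 : Complex.ofRealCLM.compLpL 2 (AddCircle.haarAddCircle (T := 2 * π)) f
      = Complex.ofRealCLM.compLpL 2 (AddCircle.haarAddCircle (T := 2 * π)) g := by
    apply fourierBasis.repr.injective
    ext k
    rw [← fhat_eq, ← fhat_eq, h k]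
  refine Lp.ext ?_
  filter_upwards [Complex.ofRealCLM.coeFn_compLpL (p := 2) f,
    Complex.ofRealCLM.coeFn_compLpL (p := 2) g] with x hf hg
  rw [h1, hg] at hf
  simpa using hf.symm

/-- The Fourier multiplier `op(a(k))` with symbol `a`, on real valued functions: `fourierMul a f`
is the element of `L²` whose `k`-th Fourier coefficient is `a(k) f̂(k)` for every `k`; it is unique,
and it exists if and only if `a(-k) f̂(-k)` is the conjugate of `a(k) f̂(k)` for every `k` and these
numbers are square-summable (otherwise the value is set to be `0`). -/
def fourierMul (a : ℤ → ℂ) (f : S1 → ℝ) : L2 :=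
  open Classical in
  if h : ∃ g : L2, ∀ k, fhat g k = a k * fhat f k then h.choose else 0

theorem fourierMul_eq {a : ℤ → ℂ} {f : S1 → ℝ} {g : L2}
    (h : ∀ k, fhat g k = a k * fhat f k) : fourierMul a f = g := by
  have h' : ∃ g : L2, ∀ k, fhat g k = a k * fhat f k := ⟨g, h⟩
  rw [fourierMul, dif_pos h']
  exact fhat_injective fun k => by rw [h'.choose_spec k, h k]

open ComplexConjugate in
theorem fhat_conj (f : S1 → ℝ) (k : ℤ) : fhat f (-k) = conj (fhat f k) := by
  simp only [fhat, fourierCoeff]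
  rw [← integral_conj]
  congr 1; ext x
  simp only [smul_eq_mul, map_mul, Complex.conj_ofReal, ← fourier_neg]

open ComplexConjugate in
/-- Every conjugate symmetric square-summable sequence is the sequence of Fourier coefficients of a
real valued `L²` function. -/
theorem exists_of_coeff (c : ℤ → ℂ) (hc : ∀ k, c (-k) = conj (c k))
    (hs : Summable fun k => ‖c k‖ ^ 2) : ∃ g : L2, ∀ k, fhat g k = c k := by
  have hm : Memℓp (E := fun _ : ℤ => ℂ) c 2 := by
    rw [memℓp_gen_iff (by norm_num)]
    simpa using hs
  let G : Lp ℂ 2 (AddCircle.haarAddCircle (T := 2 * π)) := fourierBasis.repr.symm ⟨c, hm⟩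
  have hG : ∀ k, fourierCoeff G k = c k := by
    intro k
    rw [← fourierBasis_repr]; simp [G]
  refine ⟨Complex.reCLM.compLpL 2 _ G, fun k => ?_⟩
  have h1 : fhat (Complex.reCLM.compLpL 2 _ G : L2) k
      = fourierCoeff (fun x => ((2:ℂ)⁻¹) * (G x + conj (G x))) k := by
    refine congrFun (fourierCoeff_congr_ae ?_) k
    filter_upwards [Complex.reCLM.coeFn_compLpL (p := 2) G] with x hx
    rw [hx]; simp [Complex.re_eq_add_conj]; ring
  have hGi : Integrable G AddCircle.haarAddCircle := (Lp.memLp G).integrable (by norm_num)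
  have hci : Integrable (fun x => conj (G x)) AddCircle.haarAddCircle :=
    (Complex.conjCLE.toContinuousLinearMap.integrable_comp hGi)
  have h2 : fourierCoeff (fun x => conj (G x)) k = conj (fourierCoeff G (-k)) := by
    simp only [fourierCoeff]
    rw [← integral_conj]
    congr 1; ext x
    simp only [smul_eq_mul, map_mul, ← fourier_neg, neg_neg]
  rw [h1, fourierCoeff.const_mul]
  have := congrFun (fourierCoeff.add hGi hci) k
  simp only [Pi.add_apply] at this
  change _ * fourierCoeff (⇑G + fun x => conj (G x)) k = _
  rw [this, h2, hG, hG, hc, Complex.conj_conj]; ring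

open ComplexConjugate in
/-- `fourierMul a f` has the Fourier coefficients `a(k) f̂(k)` as soon as these are square-summable
and the symbol is conjugate symmetric. -/
theorem fourierMul_spec {a : ℤ → ℂ} {f : S1 → ℝ} (ha : ∀ k, a (-k) = conj (a k))
    (hs : Summable fun k => ‖a k * fhat f k‖ ^ 2) (k : ℤ) :
    fhat (fourierMul a f) k = a k * fhat f k := by
  obtain ⟨g, hg⟩ := exists_of_coeff (fun k => a k * fhat f k)
    (fun k => by simp [ha, fhat_conj]) hs
  rw [fourierMul_eq hg, hg]

/-- The derivative `D = d/dx`, i.e. the Fourier multiplier with symbol `i k`. -/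
def D (f : S1 → ℝ) : L2 := fourierMul (fun k => Complex.I * k) f

/-- The weight `(1 + k²)^s`. -/
def weight (s : ℝ) (k : ℤ) : ℝ := (1 + (k : ℝ) ^ 2) ^ s

theorem one_le_base (k : ℤ) : (1 : ℝ) ≤ 1 + (k : ℝ) ^ 2 := by nlinarith [sq_nonneg (k : ℝ)]

theorem weight_pos (s : ℝ) (k : ℤ) : 0 < weight s k :=
  Real.rpow_pos_of_pos (by linarith [one_le_base k]) s

theorem weight_mono {s t : ℝ} (h : s ≤ t) (k : ℤ) : weight s k ≤ weight t k :=
  Real.rpow_le_rpow_of_exponent_le (one_le_base k) h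

theorem weight_half_sq (s : ℝ) (k : ℤ) : weight (s / 2) k ^ 2 = weight s k := by
  rw [weight, weight, ← Real.rpow_natCast, ← Real.rpow_mul (by linarith [one_le_base k])]
  norm_num

theorem norm_weight_mul_sq (s : ℝ) (k : ℤ) (z : ℂ) :
    ‖(weight (s / 2) k : ℂ) * z‖ ^ 2 = weight s k * ‖z‖ ^ 2 := by
  rw [norm_mul, mul_pow, Complex.norm_real, Real.norm_eq_abs, sq_abs, weight_half_sq]

theorem memlp_iff (s : ℝ) (f : L2) :
    Memℓp (E := fun _ : ℤ => ℂ) (fun k => (weight (s / 2) k : ℂ) * fhat f k) 2 ↔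
      Summable fun k => weight s k * ‖fhat f k‖ ^ 2 := by
  rw [memℓp_gen_iff (by norm_num)]
  have : (2 : ENNReal).toReal = ((2 : ℕ) : ℝ) := by norm_num
  simp only [this, Real.rpow_natCast, norm_weight_mul_sq]

/-- The functions `f ∈ L²` with `∑ (1 + k²)^s |f̂(k)|² < ∞`. -/
def sobolevSubmodule (s : ℝ) : Submodule ℝ L2 where
  carrier := {f | Summable fun k : ℤ => weight s k * ‖fhat f k‖ ^ 2}
  zero_mem' := by
    change Summable fun k : ℤ => weight s k * ‖fhat (0 : L2) k‖ ^ 2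
    simp only [fhat_zero, norm_zero, ne_eq, OfNat.ofNat_ne_zero, not_false_eq_true, zero_pow,
      mul_zero, summable_zero]
  add_mem' := by
    intro f g hf hg
    refine (memlp_iff s _).1 ?_
    have h := ((memlp_iff s f).2 hf).add ((memlp_iff s g).2 hg)
    convert h using 2 with k
    rw [fhat_add, mul_add]
    rfl
  smul_mem' := by
    intro c f hf
    refine (memlp_iff s _).1 ?_
    have h := ((memlp_iff s f).2 hf).const_smul (c : ℂ)
    convert h using 2 with k
    rw [fhat_smul, mul_left_comm]
    rfl

/-- The real Sobolev space `H^s` of the circle, for `s ≥ 0` (a separate type, because its norm is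
not the norm of `L²`). -/
def SobolevSpace (s : ℝ) : Type := sobolevSubmodule s

namespace SobolevSpace

instance (s : ℝ) : AddCommGroup (SobolevSpace s) :=
  inferInstanceAs (AddCommGroup (sobolevSubmodule s))

instance (s : ℝ) : Module ℝ (SobolevSpace s) :=
  inferInstanceAs (Module ℝ (sobolevSubmodule s))

/-- The inclusion of `H^s` into `L²`. -/
def toL2 (s : ℝ) : SobolevSpace s →ₗ[ℝ] L2 := (sobolevSubmodule s).subtype

theorem summable {s : ℝ} (f : SobolevSpace s) :
    Summable fun k : ℤ => weight s k * ‖fhat (toL2 s f) k‖ ^ 2 := f.2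

/-- The map sending `f ∈ H^s` to the square-summable sequence `(1 + k²)^(s/2) f̂(k)`. -/
def toSeq (s : ℝ) : SobolevSpace s →ₗ[ℝ] lp (fun _ : ℤ => ℂ) 2 where
  toFun f := ⟨fun k => (weight (s / 2) k : ℂ) * fhat (toL2 s f) k, (memlp_iff s _).2 f.summable⟩
  map_add' f g := by
    ext k
    change (weight (s / 2) k : ℂ) * fhat (toL2 s f + toL2 s g : L2) k = _ * _ + _ * _
    rw [fhat_add, mul_add]
  map_smul' c f := by
    ext k
    change (weight (s / 2) k : ℂ) * fhat (c • toL2 s f : L2) k = c • (_ * _)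
    rw [fhat_smul, mul_left_comm, Complex.real_smul]

theorem toSeq_injective (s : ℝ) : Function.Injective (toSeq s) := by
  intro f g h
  apply Subtype.ext
  refine fhat_injective fun k => ?_
  have hk : (weight (s / 2) k : ℂ) * fhat (toL2 s f) k
      = (weight (s / 2) k : ℂ) * fhat (toL2 s g) k := congrArg (fun v => v.1 k) h
  exact mul_left_cancel₀ (by exact_mod_cast (weight_pos (s / 2) k).ne') hk

/-- `H^s` carries the norm `(∑ (1 + k²)^s |f̂(k)|²)^(1/2)`; see `norm_sq_eq`. -/
instance (s : ℝ) : NormedAddCommGroup (SobolevSpace s) :=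
  NormedAddCommGroup.induced _ _ (toSeq s) (toSeq_injective s)

instance (s : ℝ) : NormedSpace ℝ (SobolevSpace s) :=
  NormedSpace.induced ℝ (SobolevSpace s) (lp (fun _ : ℤ => ℂ) 2) (toSeq s)

theorem norm_sq_eq {s : ℝ} (f : SobolevSpace s) :
    ‖f‖ ^ 2 = ∑' k : ℤ, weight s k * ‖fhat (toL2 s f) k‖ ^ 2 := by
  have h := lp.norm_rpow_eq_tsum (p := 2) (by norm_num) (toSeq s f)
  have h2 : (2 : ENNReal).toReal = ((2 : ℕ) : ℝ) := by norm_num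
  simp only [h2, Real.rpow_natCast] at h
  change ‖toSeq s f‖ ^ 2 = _
  rw [h]
  exact tsum_congr fun k => norm_weight_mul_sq s k _

/-- The inclusion of `H^s` into `H^t` for `t ≤ s`. -/
def incl {t s : ℝ} (h : t ≤ s) : SobolevSpace s →ₗ[ℝ] SobolevSpace t :=
  Submodule.inclusion (p := sobolevSubmodule s) (p' := sobolevSubmodule t) fun _ hf =>
    Summable.of_nonneg_of_le (fun k => mul_nonneg (weight_pos t k).le (sq_nonneg _))
      (fun k => mul_le_mul_of_nonneg_right (weight_mono h k) (sq_nonneg _)) hf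

end SobolevSpace

/-- `a` is the symbol of a symmetric Fourier multiplier `A = op(a(k))` on real valued functions
(`a` is real and even), of order `r`, which is an isomorphism from `H^q` to `H^(q-r)` for all
`q ≥ r`: `a(k) = O(|k|^r)`, `a(k) ≠ 0` and `1 / a(k) = O(|k|^(-r))`. -/
structure IsInertiaSymbol (r : ℝ) (a : ℤ → ℝ) : Prop where
  even : ∀ k, a (-k) = a k
  order : ∃ C : ℝ, ∀ k, |a k| ≤ C * weight (r / 2) k
  ne_zero : ∀ k, a k ≠ 0
  inv_order : ∃ C : ℝ, ∀ k, |(a k)⁻¹| ≤ C * weight (-r / 2) k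

/-- The operator `A = op(a(k))`. -/
def opA (a : ℤ → ℝ) (f : S1 → ℝ) : L2 := fourierMul (fun k => (a k : ℂ)) f

/-- The operator `A⁻¹ = op(1 / a(k))`. -/
def opAinv (a : ℤ → ℝ) (f : S1 → ℝ) : L2 := fourierMul (fun k => ((a k : ℂ))⁻¹) f

/-- The right hand side `-A⁻¹ [u (Au)_x + 2 (Au) u_x]` of the Euler equation. -/
def eulerRHS (a : ℤ → ℝ) (u : L2) : L2 :=
  -opAinv a (fun x => u x * D (opA a u) x + 2 * opA a u x * D u x)

/-- `u ∈ C⁰(J, H^q) ∩ C¹(J, H^(q-1))` solves `u_t = -A⁻¹ [u (Au)_x + 2 (Au) u_x]` on the open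
interval `J`. -/
structure IsEulerSolution (a : ℤ → ℝ) (q : ℝ) (J : Set ℝ) (u : ℝ → SobolevSpace q) : Prop where
  continuousOn : ContinuousOn u J
  contDiffOn : ContDiffOn ℝ 1 (fun t => SobolevSpace.incl (sub_le_self q zero_le_one) (u t)) J
  euler : ∀ t ∈ J,
    SobolevSpace.toL2 (q - 1)
        (deriv (fun τ => SobolevSpace.incl (sub_le_self q zero_le_one) (u τ)) t)
      = eulerRHS a (SobolevSpace.toL2 q (u t))

end EulerCircle

end

/-!
Let `m = Au`, so that `m_t + u m_x + 2 u_x m = 0`, and put `σ = q - r ≥ 1`. The argument consists of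
two energy estimates.

Formally `d/dt ∫ m² = -3 ∫ u_x m²`, so a lower bound for `u_x` bounds `m` in `L²` on bounded time
intervals, forward in time (`IsEulerSolution.sob_zero_momentum_le`). As `a` is elliptic of order
`r ≥ 2`, this bounds `u` in `H²`. No sign of `a` is needed.

At the level `H^σ`, with `Λ = (1 - ∂²)^(1/2)`, the commutator of `Λ^σ` with the transport term is
bounded in `L²` by `‖u‖_{H²} ‖m‖_{H^σ} + ‖u‖_{H^(σ+2)} ‖m‖_{L²}`, up to a constant
(`commTransport_bound`). Because `‖u‖_{H^(σ+2)} ≤ ‖u‖_{H^q} ≲ ‖m‖_{H^σ}`, this is linear in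
`‖m‖_{H^σ}` with a constant that depends only on `‖m‖_{L²}`, which has just been bounded, and
Gronwall's inequality applies (`exists_norm_sq_le_integral`, `le_of_le_add_integral`).

All of this takes place on the Fourier side. A solution has one derivative too few for the energies
to be differentiated directly, so `Λ^σ` is replaced by weights `w` with finite support; the energy
`∑ w(k)² |m(k)|²` is then a finite sum of differentiable functions. The main term of its derivative
is `-3` times the Toeplitz form of `u_x`, which is bounded below because it is `∫ u_x |p|²` for a
trigonometric polynomial `p` (`le_toeplitz_re`, `energy_le`). The error is a commutator with `w`:
for the first estimate `w` is a tent function whose Lipschitz constant tends to zero, and for the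
second one `w` is a `1`-Lipschitz function of the weight `(1 + k²)^(σ/2)`, so that the commutator
bound is uniform in the truncation. The discrete estimates rest only on Young's inequality
`ℓ¹ * ℓ² ⊆ ℓ²` (`sum_mul_tsum_conv_le`).
-/

namespace EulerCircle

open ComplexConjugate

/-! ### Fourier coefficients of products, and Toeplitz forms -/

theorem integrable_coe (f : L2) : Integrable f (AddCircle.haarAddCircle (T := 2 * π)) :=
  (Lp.memLp f).integrable (by norm_num)

theorem integrable_mul_coe (f g : L2) :
    Integrable (fun x => f x * g x) (AddCircle.haarAddCircle (T := 2 * π)) :=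
  (Lp.memLp f).integrable_mul (Lp.memLp g)

theorem fhat_fun_add {f g : S1 → ℝ} (hf : Integrable f AddCircle.haarAddCircle)
    (hg : Integrable g AddCircle.haarAddCircle) (k : ℤ) :
    fhat (fun x => f x + g x) k = fhat f k + fhat g k := by
  have hf' : Integrable (fun x => (f x : ℂ)) (AddCircle.haarAddCircle (T := 2 * π)) := hf.ofReal
  have hg' : Integrable (fun x => (g x : ℂ)) (AddCircle.haarAddCircle (T := 2 * π)) := hg.ofReal
  have h := congrFun (fourierCoeff.add hf' hg') k
  rw [Pi.add_apply] at h
  rw [fhat, fhat, fhat]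
  refine Eq.trans ?_ h
  congr 1
  ext x
  simp

theorem fhat_const_mul (c : ℝ) (f : S1 → ℝ) (k : ℤ) :
    fhat (fun x => c * f x) k = c * fhat f k := by
  simp only [fhat, Complex.ofReal_mul]
  exact fourierCoeff.const_mul _ _ _

theorem norm_fhat_le {f : S1 → ℝ} (k : ℤ) :
    ‖fhat f k‖ ≤ ∫ x, ‖f x‖ ∂(AddCircle.haarAddCircle (T := 2 * π)) := by
  rw [fhat, fourierCoeff]
  refine (norm_integral_le_integral_norm _).trans_eq (integral_congr_ae (.of_forall fun x => ?_))
  have h : ‖(fourier (-k) x : ℂ)‖ = 1 := by rw [fourier_apply]; exact Circle.norm_coe _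
  simp only [norm_smul, h, one_mul, Complex.norm_real]

/-- The Fourier coefficients of a product of two `L²` functions are given by convolution: this is
Parseval's identity for `x ↦ exp(ikx) f(x)` and `g`. -/
theorem hasSum_fhat_mul (f g : L2) (k : ℤ) :
    HasSum (fun j => fhat f (k - j) * fhat g j) (fhat (fun x => f x * g x) k) := by
  have hmem : MemLp (fun x => (fourier k x : ℂ) * (f x : ℂ)) 2
      (AddCircle.haarAddCircle (T := 2 * π)) := by
    refine MemLp.of_le (Lp.memLp f) ?_ (.of_forall fun x => ?_)
    · exact (ContinuousMap.continuous _).aestronglyMeasurable.mul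
        (Complex.continuous_ofReal.comp_aestronglyMeasurable (Lp.aestronglyMeasurable f))
    · have h : ‖(fourier k x : ℂ)‖ = 1 := by rw [fourier_apply]; exact Circle.norm_coe _
      rw [norm_mul, h, one_mul, Complex.norm_real]
  set F : Lp ℂ 2 (AddCircle.haarAddCircle (T := 2 * π)) := hmem.toLp with hF
  set G := Complex.ofRealCLM.compLpL 2 (AddCircle.haarAddCircle (T := 2 * π)) g with hG
  have h := fourierBasis.hasSum_inner_mul_inner F G
  have hFae : ∀ᵐ x ∂(AddCircle.haarAddCircle (T := 2 * π)),
      F x = (fourier k x : ℂ) * (f x : ℂ) := hmem.coeFn_toLp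
  have hGae : ∀ᵐ x ∂(AddCircle.haarAddCircle (T := 2 * π)), G x = (g x : ℂ) :=
    Complex.ofRealCLM.coeFn_compLpL (p := 2) g
  have e1 : ∀ j, inner ℂ F (fourierBasis j) * inner ℂ (fourierBasis j) G
      = fhat f (k - j) * fhat g j := fun j => by
    congr 1
    · rw [coe_fourierBasis, L2.inner_def, fhat, fourierCoeff]
      refine integral_congr_ae ?_
      filter_upwards [hFae, coeFn_fourierLp 2 j] with x h1 h2
      rw [h1, h2, RCLike.inner_apply, map_mul, ← fourier_neg, Complex.conj_ofReal,
        smul_eq_mul, neg_sub, sub_eq_add_neg, fourier_add]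
      ring
    · rw [← HilbertBasis.repr_apply_apply, fhat_eq]
  have e2 : inner ℂ F G = fhat (fun x => f x * g x) k := by
    rw [L2.inner_def, fhat, fourierCoeff]
    refine integral_congr_ae ?_
    filter_upwards [hFae, hGae] with x h1 h2
    rw [h1, h2, RCLike.inner_apply, map_mul, ← fourier_neg, Complex.conj_ofReal,
      smul_eq_mul, Complex.ofReal_mul]
    ring
  simpa only [e1, e2] using h

theorem fhat_one (k : ℤ) : fhat (fun _ => (1 : ℝ)) k = if k = 0 then 1 else 0 := by
  have h := congrFun (fourierCoeff_fourier (T := 2 * π) 0) k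
  rw [fhat]
  rw [Pi.single_apply] at h
  rw [← h]
  congr 1
  ext x
  simp

/-- Herglotz: the Toeplitz form of a nonnegative function `g` is nonnegative, because it is
`∫ g |p|²` for a trigonometric polynomial `p`. -/
theorem toeplitz_re_nonneg {g : S1 → ℝ} (hg : Integrable g AddCircle.haarAddCircle)
    (h0 : ∀ᵐ x ∂(AddCircle.haarAddCircle (T := 2 * π)), 0 ≤ g x) (S : Finset ℤ) (b : ℤ → ℂ) :
    0 ≤ (∑ k ∈ S, ∑ j ∈ S, fhat g (k - j) * (conj (b k) * b j)).re := by
  have hint : ∀ n : ℤ, Integrable (fun x => (fourier n x : ℂ) * (g x : ℂ))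
      (AddCircle.haarAddCircle (T := 2 * π)) := fun n => by
    have hg' : Integrable (fun x => (g x : ℂ)) (AddCircle.haarAddCircle (T := 2 * π)) := hg.ofReal
    exact hg'.fourier_smul n
  have key : ∑ k ∈ S, ∑ j ∈ S, fhat g (k - j) * (conj (b k) * b j)
      = ∫ x, ((g x * ‖∑ j ∈ S, b j * (fourier j x : ℂ)‖ ^ 2 : ℝ) : ℂ)
        ∂(AddCircle.haarAddCircle (T := 2 * π)) := by
    have e1 : ∀ x : S1, ((g x * ‖∑ j ∈ S, b j * (fourier j x : ℂ)‖ ^ 2 : ℝ) : ℂ)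
        = ∑ k ∈ S, ∑ j ∈ S, ((fourier (-(k - j)) x : ℂ) * (g x : ℂ)) * (conj (b k) * b j) := by
      intro x
      rw [Complex.ofReal_mul, Complex.ofReal_pow, ← Complex.conj_mul', map_sum, Finset.sum_mul_sum,
        Finset.mul_sum]
      refine Finset.sum_congr rfl fun k _ => ?_
      rw [Finset.mul_sum]
      refine Finset.sum_congr rfl fun j _ => ?_
      rw [map_mul, ← fourier_neg, neg_sub, sub_eq_add_neg, fourier_add]
      ring
    simp_rw [e1]
    rw [integral_finsetSum _ fun k _ => integrable_finsetSum _ fun j _ =>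
      (hint _).mul_const _]
    refine Finset.sum_congr rfl fun k _ => ?_
    rw [integral_finsetSum _ fun j _ => (hint _).mul_const _]
    refine Finset.sum_congr rfl fun j _ => ?_
    rw [integral_mul_const, fhat, fourierCoeff]
    simp only [smul_eq_mul]
  rw [key, integral_complex_ofReal, Complex.ofReal_re]
  refine integral_nonneg_of_ae ?_
  filter_upwards [h0] with x hx
  positivity

/-- If `g ≥ c` almost everywhere, then the Toeplitz form of `g` is bounded below by `c`. -/
theorem le_toeplitz_re {g : S1 → ℝ} (hg : Integrable g AddCircle.haarAddCircle) {c : ℝ}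
    (h0 : ∀ᵐ x ∂(AddCircle.haarAddCircle (T := 2 * π)), c ≤ g x) (S : Finset ℤ) (b : ℤ → ℂ) :
    c * ∑ k ∈ S, ‖b k‖ ^ 2 ≤ (∑ k ∈ S, ∑ j ∈ S, fhat g (k - j) * (conj (b k) * b j)).re := by
  have hc : Integrable (fun _ : S1 => -c) (AddCircle.haarAddCircle (T := 2 * π)) :=
    integrable_const _
  have h1 := toeplitz_re_nonneg (hg.add hc) (by
    filter_upwards [h0] with x hx
    simpa using hx) S b
  have e : ∀ n : ℤ, fhat (g + fun _ : S1 => -c) n = fhat g n - if n = 0 then (c : ℂ) else 0 := by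
    intro n
    have h2 := fhat_const_mul (-c) (fun _ => 1) n
    rw [fhat_one] at h2
    simp only [mul_one] at h2
    have h3 := fhat_fun_add hg hc n
    rw [h2] at h3
    refine Eq.trans h3 ?_
    split_ifs <;> push_cast <;> ring
  simp only [e, sub_mul, Finset.sum_sub_distrib, Complex.sub_re, sub_eq_zero, ite_mul, zero_mul]
    at h1
  have e2 : (∑ k ∈ S, ∑ j ∈ S, if k = j then (c : ℂ) * (conj (b k) * b j) else 0).re
      = c * ∑ k ∈ S, ‖b k‖ ^ 2 := by
    rw [Finset.mul_sum, Complex.re_sum]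
    refine Finset.sum_congr rfl fun k hk => ?_
    rw [Finset.sum_ite_eq, if_pos hk, Complex.conj_mul', ← Complex.ofReal_pow,
      ← Complex.ofReal_mul, Complex.ofReal_re]
  rw [e2] at h1
  linarith

/-! ### Weights -/

theorem weight_mul_weight (s t : ℝ) (k : ℤ) : weight s k * weight t k = weight (s + t) k :=
  (Real.rpow_add (by linarith [one_le_base k]) s t).symm

theorem weight_zero (k : ℤ) : weight 0 k = 1 := Real.rpow_zero _

theorem one_le_weight {s : ℝ} (hs : 0 ≤ s) (k : ℤ) : 1 ≤ weight s k :=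
  Real.one_le_rpow (one_le_base k) hs

theorem weight_eq_rpow (σ : ℝ) (k : ℤ) : weight (σ / 2) k = weight (1 / 2) k ^ σ := by
  rw [weight, weight, ← Real.rpow_mul (by linarith [one_le_base k])]
  congr 1; ring

theorem weight_one_half (k : ℤ) : weight (1 / 2) k = √(1 + (k : ℝ) ^ 2) :=
  (Real.sqrt_eq_rpow _).symm

theorem abs_le_weight (k : ℤ) : |(k : ℝ)| ≤ weight (1 / 2) k := by
  rw [weight_one_half]
  exact Real.abs_le_sqrt (by linarith)

theorem weight_le_add_abs (k j : ℤ) :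
    weight (1 / 2) k ≤ weight (1 / 2) j + |((k - j : ℤ) : ℝ)| := by
  have h1 := abs_le_weight j
  have h0 := weight_pos (1 / 2) j
  have h3 : weight (1 / 2) j ^ 2 = 1 + (j : ℝ) ^ 2 := by
    rw [weight_one_half, Real.sq_sqrt (by positivity)]
  rw [weight_one_half k]
  refine Real.sqrt_le_iff.2 ⟨by positivity, ?_⟩
  push_cast
  have h4 : (j : ℝ) * (k - j) ≤ weight (1 / 2) j * |(k : ℝ) - j| := by
    calc (j : ℝ) * (k - j) ≤ |(j : ℝ) * (k - j)| := le_abs_self _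
      _ = |(j : ℝ)| * |(k : ℝ) - j| := abs_mul _ _
      _ ≤ _ := by gcongr
  nlinarith [sq_abs ((k : ℝ) - j)]

theorem abs_two_mul_sub_le (k j : ℤ) :
    |((2 * k - j : ℤ) : ℝ)| ≤ 2 * weight (1 / 2) (k - j) + weight (1 / 2) j := by
  have h1 := abs_le_weight (k - j)
  have h2 := abs_le_weight j
  calc |((2 * k - j : ℤ) : ℝ)| = |2 * ((k - j : ℤ) : ℝ) + (j : ℝ)| := by
        congr 1; push_cast; ring
    _ ≤ |2 * ((k - j : ℤ) : ℝ)| + |(j : ℝ)| := abs_add_le _ _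
    _ = 2 * |((k - j : ℤ) : ℝ)| + |(j : ℝ)| := by rw [abs_mul, abs_two]
    _ ≤ _ := by linarith

theorem abs_rpow_sub_rpow_le {x y σ : ℝ} (hx : 0 < x) (hy : 0 < y) (hσ : 1 ≤ σ) :
    |x ^ σ - y ^ σ| ≤ σ * |x - y| * max x y ^ (σ - 1) := by
  wlog h : y ≤ x generalizing x y
  · rw [abs_sub_comm, abs_sub_comm x, max_comm]
    exact this hy hx (le_of_not_ge h)
  rw [max_eq_left h, abs_of_nonneg (sub_nonneg.2 h),
    abs_of_nonneg (sub_nonneg.2 (Real.rpow_le_rpow hy.le h (by linarith)))]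
  -- Bernoulli's inequality for `y / x`
  have hb := one_add_mul_self_le_rpow_one_add (s := y / x - 1) (by
    have := div_pos hy hx
    linarith) hσ
  rw [add_sub_cancel, Real.div_rpow hy.le hx.le, le_div_iff₀ (by positivity)] at hb
  have e : x ^ σ = x * x ^ (σ - 1) := by
    rw [← Real.rpow_one_add' hx.le (by linarith)]; congr 1; ring
  have e2 : (1 + σ * (y / x - 1)) * x ^ σ = x ^ σ - σ * (x - y) * x ^ (σ - 1) := by
    rw [e]; field_simp; ring
  linarith

/-- The symbol estimate behind the commutator bound. The difference of the weights is at most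
`|k - j|` times a weight of order `σ - 1`, which makes up for the factor `2k - j`. So for each pair
`(k, j)` the `σ` derivatives beyond the first fall either on frequency `j` or on frequency
`k - j`. -/
theorem commutator_weight {σ : ℝ} (hσ : 1 ≤ σ) (k j : ℤ) :
    |weight (σ / 2) k - weight (σ / 2) j| * |((2 * k - j : ℤ) : ℝ)| ≤
      2 * σ * 2 ^ σ * (weight (1 / 2) (k - j) * weight (σ / 2) j +
        weight ((σ + 1) / 2) (k - j)) := by
  set x := weight (1 / 2) k with hx
  set y := weight (1 / 2) j with hy
  set d := weight (1 / 2) (k - j) with hd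
  have hx0 : 0 < x := weight_pos _ _
  have hy0 : 0 < y := weight_pos _ _
  have hd0 : 0 < d := weight_pos _ _
  have hdabs : |((k - j : ℤ) : ℝ)| ≤ d := abs_le_weight _
  have h1 : x ≤ y + d := (weight_le_add_abs k j).trans (by linarith)
  have h2 : |x - y| ≤ d := by
    rw [abs_le]
    have h3 := weight_le_add_abs j k
    rw [show ((j - k : ℤ) : ℝ) = -((k - j : ℤ) : ℝ) by push_cast; ring, abs_neg] at h3
    constructor <;> linarith
  have h4 : |((2 * k - j : ℤ) : ℝ)| ≤ 2 * (y + d) :=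
    (abs_two_mul_sub_le k j).trans (by linarith)
  have h6 : |x ^ σ - y ^ σ| ≤ σ * d * (y + d) ^ (σ - 1) := by
    refine (abs_rpow_sub_rpow_le hx0 hy0 hσ).trans ?_
    have : max x y ≤ y + d := max_le h1 (by linarith)
    have h7 : max x y ^ (σ - 1) ≤ (y + d) ^ (σ - 1) :=
      Real.rpow_le_rpow (le_max_of_le_left hx0.le) this (by linarith)
    gcongr
  have h8 : (y + d) ^ σ ≤ 2 ^ σ * (y ^ σ + d ^ σ) := by
    have h9 : y + d ≤ 2 * max y d := by linarith [le_max_left y d, le_max_right y d]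
    calc (y + d) ^ σ ≤ (2 * max y d) ^ σ := Real.rpow_le_rpow (by positivity) h9 (by linarith)
      _ = 2 ^ σ * max y d ^ σ := Real.mul_rpow (by norm_num) (le_max_of_le_left hy0.le)
      _ ≤ 2 ^ σ * (y ^ σ + d ^ σ) := by
        gcongr
        have := Real.rpow_nonneg hy0.le σ
        have := Real.rpow_nonneg hd0.le σ
        rcases max_choice y d with h | h <;> rw [h] <;> linarith
  have e1 : (y + d) ^ (σ - 1) * (y + d) = (y + d) ^ σ := by
    rw [← Real.rpow_add_one' (by positivity) (by linarith)]; congr 1; ring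
  have e2 : weight ((σ + 1) / 2) (k - j) = d * d ^ σ := by
    rw [weight_eq_rpow, ← Real.rpow_one_add' hd0.le (by linarith)]; congr 1; ring
  rw [weight_eq_rpow σ k, weight_eq_rpow σ j, e2, ← hx, ← hy]
  calc |x ^ σ - y ^ σ| * |((2 * k - j : ℤ) : ℝ)|
      ≤ (σ * d * (y + d) ^ (σ - 1)) * (2 * (y + d)) := by gcongr
    _ = 2 * σ * d * ((y + d) ^ (σ - 1) * (y + d)) := by ring
    _ ≤ 2 * σ * d * (2 ^ σ * (y ^ σ + d ^ σ)) := by rw [e1]; gcongr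
    _ = _ := by ring

/-! ### Weighted square-summable sequences -/

/-- `∑ (1 + k²)^s |c(k)|² < ∞`. -/
def MemSob (s : ℝ) (c : ℤ → ℂ) : Prop := Summable fun k => weight s k * ‖c k‖ ^ 2

/-- The norm `(∑ (1 + k²)^s |c(k)|²)^(1/2)` of a sequence; `0` if the sum diverges. -/
noncomputable def sob (s : ℝ) (c : ℤ → ℂ) : ℝ := √(∑' k, weight s k * ‖c k‖ ^ 2)

theorem weight_mul_sq_nonneg (s : ℝ) (c : ℤ → ℂ) (k : ℤ) : 0 ≤ weight s k * ‖c k‖ ^ 2 :=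
  mul_nonneg (weight_pos s k).le (sq_nonneg _)

theorem sob_nonneg (s : ℝ) (c : ℤ → ℂ) : 0 ≤ sob s c := Real.sqrt_nonneg _

theorem sob_sq (s : ℝ) (c : ℤ → ℂ) : sob s c ^ 2 = ∑' k, weight s k * ‖c k‖ ^ 2 :=
  Real.sq_sqrt (tsum_nonneg (weight_mul_sq_nonneg s c))

/-- Multiplication by a symbol of order `p` maps sequences of order `s + p` to order `s`. -/
theorem MemSob.multiplier {s p C : ℝ} {c e : ℤ → ℂ}
    (h : ∀ k, ‖e k‖ ≤ C * weight (p / 2) k * ‖c k‖) (hc : MemSob (s + p) c) :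
    MemSob s e ∧ sob s e ≤ |C| * sob (s + p) c := by
  have h1 : ∀ k, weight s k * ‖e k‖ ^ 2 ≤ C ^ 2 * (weight (s + p) k * ‖c k‖ ^ 2) := by
    intro k
    have hw := (weight_pos s k).le
    calc weight s k * ‖e k‖ ^ 2 ≤ weight s k * (C * weight (p / 2) k * ‖c k‖) ^ 2 := by
          gcongr; exact h k
      _ = _ := by
        rw [mul_pow, mul_pow, weight_half_sq, ← weight_mul_weight]; ring
  have hs : MemSob s e := Summable.of_nonneg_of_le (weight_mul_sq_nonneg s e) h1 (hc.mul_left _)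
  refine ⟨hs, ?_⟩
  rw [sob, sob, ← Real.sqrt_sq_eq_abs, ← Real.sqrt_mul (sq_nonneg _), ← tsum_mul_left]
  exact Real.sqrt_le_sqrt (Summable.tsum_le_tsum h1 hs (hc.mul_left _))

theorem MemSob.of_le {s t : ℝ} (h : s ≤ t) {c : ℤ → ℂ} (hc : MemSob t c) :
    MemSob s c ∧ sob s c ≤ sob t c := by
  have h1 : ∀ k, weight s k * ‖c k‖ ^ 2 ≤ weight t k * ‖c k‖ ^ 2 := fun k =>
    mul_le_mul_of_nonneg_right (weight_mono h k) (sq_nonneg _)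
  have hs : MemSob s c := Summable.of_nonneg_of_le (weight_mul_sq_nonneg s c) h1 hc
  exact ⟨hs, Real.sqrt_le_sqrt (Summable.tsum_le_tsum h1 hs hc)⟩

theorem summable_weight_neg_one : Summable (weight (-1)) := by
  have h : Summable fun k : ℤ => 1 / (k : ℝ) ^ 2 :=
    Real.summable_one_div_int_pow.2 (by norm_num)
  refine h.of_norm_bounded_eventually ?_
  filter_upwards [(Set.finite_singleton (0 : ℤ)).compl_mem_cofinite] with k hk
  have hk0 : (k : ℝ) ≠ 0 := by exact_mod_cast hk
  have hk2 : 0 < (k : ℝ) ^ 2 := by positivity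
  rw [Real.norm_of_nonneg (weight_pos _ _).le, weight, Real.rpow_neg_one, ← one_div]
  gcongr
  linarith

theorem tsum_mul_le_sqrt_mul_sqrt {f g : ℤ → ℝ} (hf : ∀ k, 0 ≤ f k) (hg : ∀ k, 0 ≤ g k)
    (hf2 : Summable fun k => f k ^ 2) (hg2 : Summable fun k => g k ^ 2) :
    (Summable fun k => f k * g k) ∧
      ∑' k, f k * g k ≤ √(∑' k, f k ^ 2) * √(∑' k, g k ^ 2) := by
  have hb : ∀ S : Finset ℤ,
      ∑ k ∈ S, f k * g k ≤ √(∑' k, f k ^ 2) * √(∑' k, g k ^ 2) := fun S =>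
    (Real.sum_mul_le_sqrt_mul_sqrt S f g).trans (mul_le_mul
      (Real.sqrt_le_sqrt (hf2.sum_le_tsum S fun k _ => sq_nonneg _))
      (Real.sqrt_le_sqrt (hg2.sum_le_tsum S fun k _ => sq_nonneg _))
      (Real.sqrt_nonneg _) (Real.sqrt_nonneg _))
  have h0 : ∀ k, 0 ≤ f k * g k := fun k => mul_nonneg (hf k) (hg k)
  exact ⟨summable_of_sum_le h0 hb, Real.tsum_le_of_sum_le h0 hb⟩

/-- The embedding constant `(∑ (1 + k²)^(-1))^(1/2)` of `H^s` into the Wiener algebra, `s ≥ 1`. -/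
noncomputable def wienerConst : ℝ := √(∑' k, weight (-1) k)

theorem MemSob.summable_weight_mul_norm {p : ℝ} {c : ℤ → ℂ} (hc : MemSob (2 * p + 1) c) :
    (Summable fun k => weight p k * ‖c k‖) ∧
      ∑' k, weight p k * ‖c k‖ ≤ wienerConst * sob (2 * p + 1) c := by
  have e1 : ∀ k, weight (-1 / 2) k ^ 2 = weight (-1) k := weight_half_sq (-1)
  have e2 : ∀ k, (weight ((2 * p + 1) / 2) k * ‖c k‖) ^ 2 = weight (2 * p + 1) k * ‖c k‖ ^ 2 :=
    fun k => by rw [mul_pow, weight_half_sq]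
  have e3 : ∀ k, weight (-1 / 2) k * (weight ((2 * p + 1) / 2) k * ‖c k‖) = weight p k * ‖c k‖ :=
    fun k => by rw [← mul_assoc, weight_mul_weight]; congr 2; ring
  have h := tsum_mul_le_sqrt_mul_sqrt (f := weight (-1 / 2))
    (g := fun k => weight ((2 * p + 1) / 2) k * ‖c k‖) (fun k => (weight_pos _ k).le)
    (fun k => mul_nonneg (weight_pos _ k).le (norm_nonneg _))
    (by simpa only [e1] using summable_weight_neg_one) (by simp only [e2]; exact hc)
  simp only [e1, e2, e3] at h
  exact h

/-- Young's inequality `ℓ¹ * ℓ² ⊆ ℓ²`, in dual form. -/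
theorem sum_mul_tsum_conv_le (S : Finset ℤ) {f g h : ℤ → ℝ} (hg : ∀ k, 0 ≤ g k)
    (hh : ∀ k, 0 ≤ h k) (hgs : Summable g) (hhs : Summable fun k => h k ^ 2) :
    (∀ k, Summable fun j => g (k - j) * h j) ∧
      ∑ k ∈ S, f k * ∑' j, g (k - j) * h j ≤
        (∑' k, g k) * √(∑ k ∈ S, f k ^ 2) * √(∑' k, h k ^ 2) := by
  have hhb : ∀ k, h k ≤ √(∑' k, h k ^ 2) := fun k =>
    Real.le_sqrt_of_sq_le (hhs.le_tsum k fun _ _ => sq_nonneg _)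
  have hsd : ∀ k, Summable fun d => g d * h (k - d) := fun k =>
    Summable.of_nonneg_of_le (fun d => mul_nonneg (hg d) (hh _))
      (fun d => mul_le_mul_of_nonneg_left (hhb _) (hg d)) (hgs.mul_right _)
  have e : ∀ k, (fun j => g (k - j) * h j) = (fun d => g d * h (k - d)) ∘ Equiv.subLeft k := by
    intro k; ext j; simp
  refine ⟨fun k => ?_, ?_⟩
  · rw [e]; exact (Equiv.summable_iff (Equiv.subLeft k)).2 (hsd k)
  have e2 : ∀ k, ∑' j, g (k - j) * h j = ∑' d, g d * h (k - d) := fun k => by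
    rw [e]; exact Equiv.tsum_eq (Equiv.subLeft k) fun d => g d * h (k - d)
  simp only [e2, ← tsum_mul_left]
  rw [← Summable.tsum_finsetSum fun k _ => (hsd k).mul_left _, mul_assoc, ← tsum_mul_right]
  refine Summable.tsum_le_tsum (fun d => ?_)
    (summable_sum fun k _ => (hsd k).mul_left _) (hgs.mul_right _)
  calc ∑ k ∈ S, f k * (g d * h (k - d)) = g d * ∑ k ∈ S, f k * h (k - d) := by
        rw [Finset.mul_sum]; exact Finset.sum_congr rfl fun k _ => by ring
    _ ≤ g d * (√(∑ k ∈ S, f k ^ 2) * √(∑ k ∈ S, h (k - d) ^ 2)) := by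
        gcongr
        · exact hg d
        · exact Real.sum_mul_le_sqrt_mul_sqrt S f _
    _ ≤ g d * (√(∑ k ∈ S, f k ^ 2) * √(∑' k, h k ^ 2)) := by
        gcongr
        · exact hg d
        · have h3 : Summable fun k => h (k - d) ^ 2 :=
            (Equiv.summable_iff (Equiv.subRight d)).2 hhs
          refine (h3.sum_le_tsum S fun _ _ => sq_nonneg _).trans_eq ?_
          exact Equiv.tsum_eq (Equiv.subRight d) fun k => h k ^ 2

/-! ### The energy identity and the commutator estimate -/

/-- The Fourier coefficients of `U m_x + 2 U_x m`, for sequences `U` and `m`. -/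
noncomputable def transport (U m : ℤ → ℂ) (k : ℤ) : ℂ :=
  ∑' j, U (k - j) * (Complex.I * ((2 * k - j : ℤ) : ℂ)) * m j

/-- The commutator of the transport term with the multiplier `w`. -/
noncomputable def commTransport (w : ℤ → ℝ) (U m : ℤ → ℂ) (k : ℤ) : ℂ :=
  ∑' j, ((w k - w j : ℝ) : ℂ) * (U (k - j) * (Complex.I * ((2 * k - j : ℤ) : ℂ)) * m j)

/-- The commutator of the transport term with a weight of order `σ`: in each product one factor is
placed in `ℓ¹` and the other in `ℓ²`, and only one of the factors `U` and `m` carries its top order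
norm. -/
theorem commTransport_bound {σ B : ℝ} {w : ℤ → ℝ} {U m : ℤ → ℂ} (S : Finset ℤ)
    (hw0 : ∀ k, 0 ≤ w k) (hw : ∀ k, w k ≤ weight (σ / 2) k) (hB0 : 0 ≤ B)
    (hB : ∀ k j, |w k - w j| * |((2 * k - j : ℤ) : ℝ)| ≤
      B * (weight (1 / 2) (k - j) * weight (σ / 2) j + weight ((σ + 1) / 2) (k - j)))
    (hσ : 0 ≤ σ) (hU : MemSob (σ + 2) U) (hm : MemSob σ m) :
    ‖∑ k ∈ S, conj ((w k : ℂ) * m k) * commTransport w U m k‖ ≤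
      B * wienerConst * (sob 2 U * sob σ m + sob (σ + 2) U * sob 0 m) * sob σ m := by
  have hm0 := hm.of_le hσ
  have hU2 := hU.of_le (show (2 : ℝ) ≤ σ + 2 by linarith)
  set f : ℤ → ℝ := fun k => w k * ‖m k‖ with hf
  have hf0 : ∀ k, 0 ≤ f k := fun k => mul_nonneg (hw0 k) (norm_nonneg _)
  have hfS : √(∑ k ∈ S, f k ^ 2) ≤ sob σ m := by
    refine Real.sqrt_le_sqrt ((Finset.sum_le_sum fun k _ => ?_).trans
      (hm.sum_le_tsum S fun k _ => weight_mul_sq_nonneg σ m k))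
    rw [hf, ← weight_half_sq, ← mul_pow]
    have := hw k
    have := hw0 k
    dsimp only
    gcongr
  have g1 := MemSob.summable_weight_mul_norm (p := 1 / 2) (c := U) (by convert hU2.1 using 1; ring)
  have g2 := MemSob.summable_weight_mul_norm (p := (σ + 1) / 2) (c := U)
    (by convert hU using 1; ring)
  rw [show 2 * (1 / 2 : ℝ) + 1 = 2 by norm_num] at g1
  rw [show 2 * ((σ + 1) / 2) + 1 = σ + 2 by ring] at g2
  have eh1 : ∀ j, (weight (σ / 2) j * ‖m j‖) ^ 2 = weight σ j * ‖m j‖ ^ 2 := fun j => by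
    rw [mul_pow, weight_half_sq]
  have eh2 : ∀ j, weight 0 j * ‖m j‖ ^ 2 = ‖m j‖ ^ 2 := fun j => by rw [weight_zero, one_mul]
  have y1 := sum_mul_tsum_conv_le S (f := f) (g := fun k => weight (1 / 2) k * ‖U k‖)
    (h := fun j => weight (σ / 2) j * ‖m j‖)
    (fun k => mul_nonneg (weight_pos _ _).le (norm_nonneg _))
    (fun k => mul_nonneg (weight_pos _ _).le (norm_nonneg _)) g1.1
    (by simp only [eh1]; exact hm)
  have y2 := sum_mul_tsum_conv_le S (f := f) (g := fun k => weight ((σ + 1) / 2) k * ‖U k‖)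
    (h := fun j => ‖m j‖)
    (fun k => mul_nonneg (weight_pos _ _).le (norm_nonneg _))
    (fun k => norm_nonneg _) g2.1
    (by simpa only [MemSob, eh2] using hm0.1)
  have n1 : √(∑' j, (weight (σ / 2) j * ‖m j‖) ^ 2) = sob σ m := by simp only [eh1]; rfl
  have n2 : √(∑' j, ‖m j‖ ^ 2) = sob 0 m := by rw [sob]; simp only [eh2]
  rw [n1] at y1
  rw [n2] at y2
  have hterm : ∀ k, ‖commTransport w U m k‖ ≤
      B * ((∑' j, weight (1 / 2) (k - j) * ‖U (k - j)‖ * (weight (σ / 2) j * ‖m j‖)) +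
        ∑' j, weight ((σ + 1) / 2) (k - j) * ‖U (k - j)‖ * ‖m j‖) := by
    intro k
    rw [← (y1.1 k).tsum_add (y2.1 k), ← tsum_mul_left]
    refine tsum_of_norm_bounded (((y1.1 k).add (y2.1 k)).mul_left B).hasSum fun j => ?_
    calc ‖((w k - w j : ℝ) : ℂ) * (U (k - j) * (Complex.I * ((2 * k - j : ℤ) : ℂ)) * m j)‖
        = (|w k - w j| * |((2 * k - j : ℤ) : ℝ)|) * (‖U (k - j)‖ * ‖m j‖) := by
          simp only [norm_mul, Complex.norm_real, Real.norm_eq_abs, Complex.norm_I,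
            Complex.norm_intCast, one_mul]
          ring
      _ ≤ (B * (weight (1 / 2) (k - j) * weight (σ / 2) j + weight ((σ + 1) / 2) (k - j))) *
          (‖U (k - j)‖ * ‖m j‖) :=
          mul_le_mul_of_nonneg_right (hB k j) (by positivity)
      _ = _ := by ring
  have hC0 : 0 ≤ wienerConst := Real.sqrt_nonneg _
  have hA1 : 0 ≤ ∑' k, weight (1 / 2) k * ‖U k‖ :=
    tsum_nonneg fun k => mul_nonneg (weight_pos _ _).le (norm_nonneg _)
  have hA2 : 0 ≤ ∑' k, weight ((σ + 1) / 2) k * ‖U k‖ :=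
    tsum_nonneg fun k => mul_nonneg (weight_pos _ _).le (norm_nonneg _)
  have hs0 := sob_nonneg 0 m
  have hsσ := sob_nonneg σ m
  calc ‖∑ k ∈ S, conj ((w k : ℂ) * m k) * commTransport w U m k‖
      ≤ ∑ k ∈ S, f k * (B * ((∑' j, weight (1 / 2) (k - j) * ‖U (k - j)‖ *
          (weight (σ / 2) j * ‖m j‖)) +
          ∑' j, weight ((σ + 1) / 2) (k - j) * ‖U (k - j)‖ * ‖m j‖)) := by
        refine (norm_sum_le _ _).trans (Finset.sum_le_sum fun k _ => ?_)
        rw [norm_mul, Complex.norm_conj, norm_mul, Complex.norm_real,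
          Real.norm_of_nonneg (hw0 k)]
        exact mul_le_mul_of_nonneg_left (hterm k) (hf0 k)
    _ = B * (∑ k ∈ S, f k * ∑' j, weight (1 / 2) (k - j) * ‖U (k - j)‖ *
          (weight (σ / 2) j * ‖m j‖)) +
        B * ∑ k ∈ S, f k * ∑' j, weight ((σ + 1) / 2) (k - j) * ‖U (k - j)‖ * ‖m j‖ := by
        rw [Finset.mul_sum, Finset.mul_sum, ← Finset.sum_add_distrib]
        exact Finset.sum_congr rfl fun k _ => by ring
    _ ≤ B * ((wienerConst * sob 2 U) * sob σ m * sob σ m) +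
        B * ((wienerConst * sob (σ + 2) U) * sob σ m * sob 0 m) := by
        gcongr
        · refine y1.2.trans ?_
          gcongr
          · exact mul_nonneg hC0 (sob_nonneg _ _)
          · exact g1.2
        · refine y2.2.trans ?_
          gcongr
          · exact mul_nonneg hC0 (sob_nonneg _ _)
          · exact g2.2
    _ = _ := by ring

/-- The part of the transport term which commutes with `w` is, after taking real parts,
`(3/2)` times a Toeplitz form in the symbol `i k U(k)`: since `U(k - j) conj(b(k)) b(j)` is
Hermitian in `(k, j)`, the contribution of the symmetric part `(k + j) / 2` of
`2k - j = (3/2) (k - j) + (k + j) / 2` is purely imaginary. -/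
theorem transport_symm {U : ℤ → ℂ} (hU : ∀ k, U (-k) = conj (U k)) (S : Finset ℤ) (b : ℤ → ℂ) :
    2 * (∑ k ∈ S, ∑ j ∈ S, U (k - j) * (Complex.I * ((2 * k - j : ℤ) : ℂ)) *
        (conj (b k) * b j)).re =
      3 * (∑ k ∈ S, ∑ j ∈ S, (Complex.I * ((k - j : ℤ) : ℂ) * U (k - j)) *
        (conj (b k) * b j)).re := by
  set Q := ∑ k ∈ S, ∑ j ∈ S, U (k - j) * (Complex.I * ((k + j : ℤ) : ℂ)) * (conj (b k) * b j)
    with hQ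
  have h1 : conj Q = -Q := by
    rw [hQ, ← Finset.sum_neg_distrib]
    simp only [map_sum]
    rw [Finset.sum_comm]
    refine Finset.sum_congr rfl fun k _ => ?_
    rw [← Finset.sum_neg_distrib]
    refine Finset.sum_congr rfl fun j _ => ?_
    simp only [map_mul, Complex.conj_conj, Complex.conj_I, map_intCast]
    rw [← hU, neg_sub, add_comm j k]
    ring
  have h2 : Q.re = 0 := by
    have := congrArg Complex.re h1
    rw [Complex.conj_re, Complex.neg_re] at this
    linarith
  have h3 : 2 * (∑ k ∈ S, ∑ j ∈ S, U (k - j) * (Complex.I * ((2 * k - j : ℤ) : ℂ)) *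
        (conj (b k) * b j)) =
      3 * (∑ k ∈ S, ∑ j ∈ S, (Complex.I * ((k - j : ℤ) : ℂ) * U (k - j)) *
        (conj (b k) * b j)) + Q := by
    rw [hQ]
    simp only [Finset.mul_sum]
    rw [← Finset.sum_add_distrib]
    refine Finset.sum_congr rfl fun k _ => ?_
    rw [← Finset.sum_add_distrib]
    refine Finset.sum_congr rfl fun j _ => ?_
    push_cast
    ring
  have h4 := congrArg Complex.re h3
  rw [Complex.add_re, h2, add_zero] at h4
  simpa using h4

theorem weighted_transport_eq {w : ℤ → ℝ} {U m : ℤ → ℂ} {S : Finset ℤ} (hS : ∀ k ∉ S, w k = 0)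
    (hsum : ∀ k, Summable fun j => U (k - j) * (Complex.I * ((2 * k - j : ℤ) : ℂ)) * m j)
    (k : ℤ) :
    (w k : ℂ) * transport U m k = commTransport w U m k +
      ∑ j ∈ S, U (k - j) * (Complex.I * ((2 * k - j : ℤ) : ℂ)) * ((w j : ℂ) * m j) := by
  have h1 : HasSum (fun j => U (k - j) * (Complex.I * ((2 * k - j : ℤ) : ℂ)) * ((w j : ℂ) * m j))
      (∑ j ∈ S, U (k - j) * (Complex.I * ((2 * k - j : ℤ) : ℂ)) * ((w j : ℂ) * m j)) :=
    hasSum_sum_of_ne_finset_zero fun j hj => by simp [hS j hj]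
  have h2 := ((hsum k).hasSum.mul_left (w k : ℂ)).sub h1
  have h3 : commTransport w U m k = (w k : ℂ) * transport U m k -
      ∑ j ∈ S, U (k - j) * (Complex.I * ((2 * k - j : ℤ) : ℂ)) * ((w j : ℂ) * m j) := by
    rw [transport, ← h2.tsum_eq, commTransport]
    refine tsum_congr fun j => ?_
    push_cast
    ring
  rw [h3]; ring

/-- The energy inequality: the time derivative of `∑ w(k)² |m(k)|²` along `m' = -(u m_x + 2 u_x m)`
is at most `-3 c ∑ w(k)² |m(k)|²` plus a commutator term, if `u_x ≥ c`. -/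
theorem energy_le {w : ℤ → ℝ} {U m : ℤ → ℂ} {S : Finset ℤ} (hS : ∀ k ∉ S, w k = 0)
    (hsum : ∀ k, Summable fun j => U (k - j) * (Complex.I * ((2 * k - j : ℤ) : ℂ)) * m j)
    (hU : ∀ k, U (-k) = conj (U k)) {v : S1 → ℝ} (hv : Integrable v AddCircle.haarAddCircle)
    {c : ℝ} (hc : ∀ᵐ x ∂(AddCircle.haarAddCircle (T := 2 * π)), c ≤ v x)
    (hvU : ∀ k, fhat v k = Complex.I * k * U k) :
    ∑ k ∈ S, w k ^ 2 * (2 * (conj (m k) * -transport U m k).re) ≤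
      -(3 * c) * ∑ k ∈ S, w k ^ 2 * ‖m k‖ ^ 2 +
        2 * ‖∑ k ∈ S, conj ((w k : ℂ) * m k) * commTransport w U m k‖ := by
  have h1 : ∑ k ∈ S, w k ^ 2 * (2 * (conj (m k) * -transport U m k).re) =
      -(2 * (∑ k ∈ S, conj ((w k : ℂ) * m k) * ((w k : ℂ) * transport U m k)).re) := by
    rw [Complex.re_sum, Finset.mul_sum, ← Finset.sum_neg_distrib]
    refine Finset.sum_congr rfl fun k _ => ?_
    rw [map_mul, Complex.conj_ofReal,
      show (w k : ℂ) * conj (m k) * ((w k : ℂ) * transport U m k) =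
        ((w k ^ 2 : ℝ) : ℂ) * (conj (m k) * transport U m k) by push_cast; ring,
      Complex.re_ofReal_mul, mul_neg, Complex.neg_re]
    ring
  have h2 := transport_symm hU S fun k => (w k : ℂ) * m k
  have h3 := le_toeplitz_re hv hc S fun k => (w k : ℂ) * m k
  have h4 : ∑ k ∈ S, ‖(w k : ℂ) * m k‖ ^ 2 = ∑ k ∈ S, w k ^ 2 * ‖m k‖ ^ 2 :=
    Finset.sum_congr rfl fun k _ => by
      rw [norm_mul, mul_pow, Complex.norm_real, Real.norm_eq_abs, sq_abs]
  have h5 : ∑ k ∈ S, conj ((w k : ℂ) * m k) * ((w k : ℂ) * transport U m k) =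
      ∑ k ∈ S, conj ((w k : ℂ) * m k) * commTransport w U m k +
      ∑ k ∈ S, ∑ j ∈ S, U (k - j) * (Complex.I * ((2 * k - j : ℤ) : ℂ)) *
        (conj ((w k : ℂ) * m k) * ((w j : ℂ) * m j)) := by
    rw [← Finset.sum_add_distrib]
    refine Finset.sum_congr rfl fun k _ => ?_
    rw [weighted_transport_eq hS hsum, mul_add, Finset.mul_sum]
    congr 1
    exact Finset.sum_congr rfl fun j _ => by ring
  simp only [hvU] at h3
  rw [h4] at h3
  rw [h1, h5, Complex.add_re]
  have h6 := (abs_le.1 (Complex.abs_re_le_norm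
    (∑ k ∈ S, conj ((w k : ℂ) * m k) * commTransport w U m k))).1
  linarith

/-! ### The momentum and its evolution -/

/-- The Fourier coefficients `a(k) f̂(k)` of the momentum `A f`. -/
noncomputable def momentum (a : ℤ → ℝ) (f : L2) (k : ℤ) : ℂ := (a k : ℂ) * fhat f k

/-- The energy `∑ w(k)² |(Af)^(k)|²`, for a weight `w` supported in the finite set `S`. -/
noncomputable def energy (a : ℤ → ℝ) (w : ℤ → ℝ) (S : Finset ℤ) (f : L2) : ℝ :=
  ∑ k ∈ S, w k ^ 2 * ‖momentum a f k‖ ^ 2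

theorem energy_nonneg (a w : ℤ → ℝ) (S : Finset ℤ) (f : L2) : 0 ≤ energy a w S f :=
  Finset.sum_nonneg fun _ _ => by positivity

theorem energy_le_sob {a w : ℤ → ℝ} {s : ℝ} (S : Finset ℤ) {f : L2} (hw0 : ∀ k, 0 ≤ w k)
    (hw : ∀ k, w k ≤ weight (s / 2) k) (hm : MemSob s (momentum a f)) :
    energy a w S f ≤ sob s (momentum a f) ^ 2 := by
  rw [sob_sq]
  refine (Finset.sum_le_sum fun k _ => ?_).trans
    (hm.sum_le_tsum S fun k _ => weight_mul_sq_nonneg s _ k)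
  rw [← weight_half_sq]
  have := hw k
  have := hw0 k
  gcongr

theorem fhat_D {f : L2} {s : ℝ} (hs : 1 ≤ s) (hf : MemSob s (fhat f)) (k : ℤ) :
    fhat (D f) k = Complex.I * k * fhat f k := by
  refine fourierMul_spec (fun k => by simp) ?_ k
  have h1 := (hf.of_le hs).1
  rw [← zero_add (1 : ℝ)] at h1
  have h := (MemSob.multiplier (C := 1) (e := fun k => Complex.I * k * fhat f k) (fun k => by
    rw [norm_mul, norm_mul, Complex.norm_I, Complex.norm_intCast, one_mul, one_mul]
    have := abs_le_weight k
    gcongr) h1).1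
  simpa only [MemSob, weight_zero, one_mul] using h

theorem momentum_bound {r : ℝ} {a : ℤ → ℝ} {C : ℝ} (hC : ∀ k, |a k| ≤ C * weight (r / 2) k)
    (f : L2) (k : ℤ) : ‖momentum a f k‖ ≤ C * weight (r / 2) k * ‖fhat f k‖ := by
  rw [momentum, norm_mul, Complex.norm_real, Real.norm_eq_abs]
  exact mul_le_mul_of_nonneg_right (hC k) (norm_nonneg _)

theorem fhat_bound_momentum {r : ℝ} {a : ℤ → ℝ} {C : ℝ} (h0 : ∀ k, a k ≠ 0)
    (hC : ∀ k, |(a k)⁻¹| ≤ C * weight (-r / 2) k) (f : L2) (k : ℤ) :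
    ‖fhat f k‖ ≤ C * weight (-r / 2) k * ‖momentum a f k‖ := by
  have h1 : ‖fhat f k‖ = |(a k)⁻¹| * ‖momentum a f k‖ := by
    rw [momentum, norm_mul, Complex.norm_real, Real.norm_eq_abs, ← mul_assoc, ← abs_mul,
      inv_mul_cancel₀ (h0 k), abs_one, one_mul]
  rw [h1]
  exact mul_le_mul_of_nonneg_right (hC k) (norm_nonneg _)

theorem fhat_opA {r : ℝ} {a : ℤ → ℝ} (ha : IsInertiaSymbol r a) {f : L2}
    (hf : MemSob r (fhat f)) (k : ℤ) : fhat (opA a f) k = momentum a f k := by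
  obtain ⟨C, hC⟩ := ha.order
  refine fourierMul_spec (fun k => by rw [ha.even, Complex.conj_ofReal]) ?_ k
  rw [← zero_add r] at hf
  simpa only [MemSob, momentum, weight_zero, one_mul] using
    (MemSob.multiplier (momentum_bound hC f) hf).1

theorem fhat_neg (f : L2) (k : ℤ) : fhat (-f : L2) k = -fhat f k := by
  rw [← neg_one_smul ℝ f, fhat_smul]; push_cast; ring

/-- The Euler equation on the Fourier side. -/
theorem momentum_eulerRHS {r q : ℝ} (hr : 2 ≤ r) (hq : r + 1 ≤ q) {a : ℤ → ℝ}
    (ha : IsInertiaSymbol r a) {f : L2} (hf : MemSob q (fhat f)) (k : ℤ) :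
    (Summable fun j => fhat f (k - j) * (Complex.I * ((2 * k - j : ℤ) : ℂ)) * momentum a f j) ∧
      momentum a (eulerRHS a f) k = -transport (fhat f) (momentum a f) k := by
  obtain ⟨Ca, hCa⟩ := ha.order
  obtain ⟨Cb, hCb⟩ := ha.inv_order
  have hA := fhat_opA ha (hf.of_le (show r ≤ q by linarith)).1
  have hAm : MemSob 1 (fhat (opA a f)) := by
    rw [funext hA]
    exact (MemSob.multiplier (momentum_bound hCa f)
      (hf.of_le (show 1 + r ≤ q by linarith)).1).1
  have hDA := fhat_D le_rfl hAm
  have hD := fhat_D (show 1 ≤ q by linarith) hf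
  set F : S1 → ℝ := fun x => f x * D (opA a f) x + 2 * opA a f x * D f x with hF
  have hi1 := integrable_mul_coe f (D (opA a f))
  have hi2 := integrable_mul_coe (D f) (opA a f)
  have hFe : F = fun x => f x * D (opA a f) x + 2 * (D f x * opA a f x) := by
    ext x; rw [hF]; ring
  have hsum : ∀ k, HasSum (fun j => fhat f (k - j) * (Complex.I * ((2 * k - j : ℤ) : ℂ)) *
      momentum a f j) (fhat F k) := by
    intro k
    have h1 := hasSum_fhat_mul f (D (opA a f)) k
    have h2 := (hasSum_fhat_mul (D f) (opA a f) k).mul_left 2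
    rw [hFe, fhat_fun_add hi1 (hi2.const_mul 2), fhat_const_mul, Complex.ofReal_ofNat]
    convert h1.add h2 using 2 with j
    rw [hDA, hA, hD]
    push_cast
    ring
  obtain ⟨K, hK⟩ : ∃ K, ∀ k, ‖fhat F k‖ ≤ K := ⟨_, fun k => norm_fhat_le k⟩
  -- `F` is merely integrable, but its Fourier coefficients are bounded and `1 / a` has order `-r ≤ -2`,
  -- so `A⁻¹ F` is a genuine element of `L²` and not the default value `0`.
  have hinv : fhat (opAinv a F) k = ((a k : ℂ))⁻¹ * fhat F k := by
    refine fourierMul_spec (fun k => by rw [ha.even, map_inv₀, Complex.conj_ofReal]) ?_ k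
    refine Summable.of_nonneg_of_le (fun _ => sq_nonneg _) (fun k => ?_)
      (summable_weight_neg_one.mul_left (Cb ^ 2 * K ^ 2))
    have h1 : ‖((a k : ℂ))⁻¹ * fhat F k‖ ≤ Cb * weight (-r / 2) k * K := by
      rw [norm_mul, ← Complex.ofReal_inv, Complex.norm_real, Real.norm_eq_abs]
      exact mul_le_mul (hCb k) (hK k) (norm_nonneg _) ((abs_nonneg _).trans (hCb k))
    calc ‖((a k : ℂ))⁻¹ * fhat F k‖ ^ 2 ≤ (Cb * weight (-r / 2) k * K) ^ 2 := by gcongr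
      _ = Cb ^ 2 * K ^ 2 * weight (-r) k := by rw [mul_pow, mul_pow, weight_half_sq]; ring
      _ ≤ _ := by gcongr; exact weight_mono (by linarith) k
  refine ⟨(hsum k).summable, ?_⟩
  have hne : (a k : ℂ) ≠ 0 := by exact_mod_cast ha.ne_zero k
  rw [transport, (hsum k).tsum_eq, momentum, eulerRHS, fhat_neg, hinv]
  field_simp

namespace SobolevSpace

theorem norm_eq_sob {s : ℝ} (f : SobolevSpace s) : ‖f‖ = sob s (fhat (toL2 s f)) := by
  rw [sob, ← norm_sq_eq, Real.sqrt_sq (norm_nonneg _)]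

theorem norm_fhat_le_norm {s : ℝ} (f : SobolevSpace s) (k : ℤ) :
    ‖fhat (toL2 s f) k‖ ≤ weight (-s / 2) k * ‖f‖ := by
  have h1 : weight s k * ‖fhat (toL2 s f) k‖ ^ 2 ≤ ‖f‖ ^ 2 := by
    rw [norm_sq_eq]
    exact f.summable.le_tsum k fun _ _ => weight_mul_sq_nonneg s _ _
  refine abs_le_of_sq_le_sq' ?_ (mul_nonneg (weight_pos _ _).le (norm_nonneg _)) |>.2
  have h2 : weight (-s) k * weight s k = 1 := by
    rw [weight_mul_weight, neg_add_cancel, weight_zero]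
  rw [mul_pow, weight_half_sq]
  calc ‖fhat (toL2 s f) k‖ ^ 2 = weight (-s) k * (weight s k * ‖fhat (toL2 s f) k‖ ^ 2) := by
        rw [← mul_assoc, h2, one_mul]
    _ ≤ _ := mul_le_mul_of_nonneg_left h1 (weight_pos _ _).le

/-- The `k`-th Fourier coefficient, as a continuous linear map on `H^s`. -/
noncomputable def fhatL (s : ℝ) (k : ℤ) : SobolevSpace s →L[ℝ] ℂ :=
  LinearMap.mkContinuous
    { toFun := fun f => fhat (toL2 s f) k
      map_add' := fun f g => by rw [map_add, fhat_add]
      map_smul' := fun c f => by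
        rw [map_smul, fhat_smul, RingHom.id_apply, Complex.real_smul] }
    (weight (-s / 2) k) fun f => norm_fhat_le_norm f k

theorem fhatL_apply (s : ℝ) (k : ℤ) (f : SobolevSpace s) : fhatL s k f = fhat (toL2 s f) k :=
  rfl

theorem sobolevSubmodule_le {t s : ℝ} (h : t ≤ s) : sobolevSubmodule s ≤ sobolevSubmodule t :=
  fun _ hf => (MemSob.of_le h hf).1

theorem toL2_incl {t s : ℝ} (h : t ≤ s) (f : SobolevSpace s) : toL2 t (incl h f) = toL2 s f :=
  LinearMap.congr_fun (Submodule.subtype_comp_inclusion _ _ (sobolevSubmodule_le h)) f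

end SobolevSpace

open SobolevSpace

theorem IsEulerSolution.hasDerivAt_momentum {r q : ℝ} (hr : 2 ≤ r) (hq : r + 1 ≤ q) {a : ℤ → ℝ}
    (ha : IsInertiaSymbol r a) {J : Set ℝ} (hJ : IsOpen J) {u : ℝ → SobolevSpace q}
    (hu : IsEulerSolution a q J u) {t : ℝ} (ht : t ∈ J) (k : ℤ) :
    HasDerivAt (fun τ => momentum a (toL2 q (u τ)) k)
      (-transport (fhat (toL2 q (u t))) (momentum a (toL2 q (u t))) k) t := by
  have h1 : DifferentiableAt ℝ (fun τ => incl (sub_le_self q zero_le_one) (u τ)) t :=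
    (hu.contDiffOn.differentiableOn (by norm_num)).differentiableAt (hJ.mem_nhds ht)
  have h2 := ((fhatL (q - 1) k).hasFDerivAt.comp_hasDerivAt t h1.hasDerivAt).const_mul (a k : ℂ)
  simp only [Function.comp_def, fhatL_apply, toL2_incl] at h2
  rw [← (momentum_eulerRHS hr hq ha (u t).summable k).2, ← hu.euler t ht]
  exact h2

/-- The weighted energies of a solution with `u_x ≥ c` satisfy a differential inequality whose error
term is controlled by the commutator constant `B` of the weight, `‖Au‖` in `L²`, and `‖u‖` in
`H^q`. The constant `K` does not depend on the weight, nor on the solution. -/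
theorem exists_energy_deriv_le {r q : ℝ} (hr : 2 ≤ r) (hq : r + 1 ≤ q) {a : ℤ → ℝ}
    (ha : IsInertiaSymbol r a) :
    ∃ K, 0 ≤ K ∧ ∀ {J : Set ℝ}, IsOpen J → ∀ {u : ℝ → SobolevSpace q}, IsEulerSolution a q J u →
      ∀ {t : ℝ}, t ∈ J → ∀ {c : ℝ}, (∀ᵐ x ∂(AddCircle.haarAddCircle (T := 2 * π)),
        c ≤ D (toL2 q (u t)) x) →
      ∀ {w : ℤ → ℝ} {S : Finset ℤ} {B : ℝ}, (∀ k ∉ S, w k = 0) → (∀ k, 0 ≤ w k) →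
      (∀ k, w k ≤ weight ((q - r) / 2) k) → 0 ≤ B →
      (∀ k j, |w k - w j| * |((2 * k - j : ℤ) : ℝ)| ≤
        B * (weight (1 / 2) (k - j) * weight ((q - r) / 2) j +
          weight ((q - r + 1) / 2) (k - j))) →
      DifferentiableAt ℝ (fun τ => energy a w S (toL2 q (u τ))) t ∧
      deriv (fun τ => energy a w S (toL2 q (u τ))) t ≤
        3 * |c| * energy a w S (toL2 q (u t)) +
          B * K * sob 0 (momentum a (toL2 q (u t))) * ‖u t‖ ^ 2 := by
  obtain ⟨Ca, hCa⟩ := ha.order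
  obtain ⟨Cb, hCb⟩ := ha.inv_order
  have hW : 0 ≤ wienerConst := Real.sqrt_nonneg _
  refine ⟨2 * (wienerConst * (|Cb| * |Ca| + 1) * |Ca|), by positivity, ?_⟩
  intro J hJ u hu t ht c hc w S B hS hw0 hw hB0 hB
  set f := toL2 q (u t) with hf
  have hU : MemSob q (fhat f) := (u t).summable
  have hmσ := MemSob.multiplier (s := q - r) (momentum_bound hCa f)
    (by rwa [sub_add_cancel])
  rw [sub_add_cancel, ← norm_eq_sob] at hmσ
  have hm0 := (hmσ.1.of_le (show 0 ≤ q - r by linarith)).1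
  have hUr := MemSob.multiplier (s := r) (fhat_bound_momentum ha.ne_zero hCb f)
    (by rwa [add_neg_cancel])
  rw [add_neg_cancel] at hUr
  have hU2 : sob 2 (fhat f) ≤ |Cb| * sob 0 (momentum a f) := (hUr.1.of_le hr).2.trans hUr.2
  have hUσ := hU.of_le (show q - r + 2 ≤ q by linarith)
  rw [← norm_eq_sob] at hUσ
  have hder : HasDerivAt (fun τ => energy a w S (toL2 q (u τ)))
      (∑ k ∈ S, w k ^ 2 * (2 * (conj (momentum a f k) *
        -transport (fhat f) (momentum a f) k).re)) t := by
    refine HasDerivAt.fun_sum fun k _ => ?_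
    have h := (hu.hasDerivAt_momentum hr hq ha hJ ht k).norm_sq
    rw [Complex.inner, mul_comm _ (conj _)] at h
    exact h.const_mul _
  refine ⟨hder.differentiableAt, ?_⟩
  rw [hder.deriv]
  have h1 := energy_le hS (fun k => (momentum_eulerRHS hr hq ha hU k).1) (fhat_conj f)
    (integrable_coe (D f)) hc (fhat_D (by linarith) hU)
  have h2 := commTransport_bound S hw0 hw hB0 hB (by linarith) hUσ.1 hmσ.1
  have h3 : -(3 * c) * energy a w S f ≤ 3 * |c| * energy a w S f := by
    have := energy_nonneg a w S f
    have := neg_abs_le c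
    gcongr
    linarith
  have hz := sob_nonneg 0 (momentum a f)
  have hy := norm_nonneg (u t)
  have h4 : B * wienerConst * (sob 2 (fhat f) * sob (q - r) (momentum a f) +
      sob (q - r + 2) (fhat f) * sob 0 (momentum a f)) * sob (q - r) (momentum a f) ≤
      B * wienerConst * ((|Cb| * sob 0 (momentum a f)) * (|Ca| * ‖u t‖) +
      ‖u t‖ * sob 0 (momentum a f)) * (|Ca| * ‖u t‖) := by
    have := hmσ.2
    have := hUσ.2
    have := sob_nonneg (q - r) (momentum a f)
    have := sob_nonneg 2 (fhat f)
    have := sob_nonneg (q - r + 2) (fhat f)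
    gcongr
  refine h1.trans (add_le_add h3 ?_)
  calc _ ≤ 2 * (B * wienerConst * ((|Cb| * sob 0 (momentum a f)) * (|Ca| * ‖u t‖) +
      ‖u t‖ * sob 0 (momentum a f)) * (|Ca| * ‖u t‖)) := by linarith
    _ = _ := by ring

open Filter Topology SobolevSpace

/-! ### An integral inequality -/

theorem hasDerivAt_integral {y : ℝ → ℝ} {J : Set ℝ} (hJ : IsOpen J) (hy : ContinuousOn y J)
    {s t x : ℝ} (hsub : Set.Icc s t ⊆ J) (hx : x ∈ Set.Icc s t) :
    HasDerivAt (fun x => ∫ τ in s..x, y τ) (y x) x := by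
  refine intervalIntegral.integral_hasDerivAt_right ?_ ?_ ?_
  · refine (hy.mono ?_).intervalIntegrable
    rw [Set.uIcc_of_le hx.1]
    exact (Set.Icc_subset_Icc_right hx.2).trans hsub
  · exact hy.stronglyMeasurableAtFilter hJ x (hsub hx)
  · exact hy.continuousAt (hJ.mem_nhds (hsub hx))

/-- Gronwall's inequality in integral form. -/
theorem le_of_le_add_integral {y : ℝ → ℝ} {J : Set ℝ} (hJ : IsOpen J) (hy : ContinuousOn y J)
    {A B s t : ℝ} (hB : 0 ≤ B) (hst : s ≤ t) (hsub : Set.Icc s t ⊆ J)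
    (h : ∀ x ∈ Set.Icc s t, y x ≤ A + B * ∫ τ in s..x, y τ) :
    y t ≤ A + B * gronwallBound 0 B A (t - s) := by
  have hG : ∀ x ∈ Set.Icc s t, HasDerivAt (fun x => ∫ τ in s..x, y τ) (y x) x :=
    fun x hx => hasDerivAt_integral hJ hy hsub hx
  have h1 := le_gronwallBound_of_liminf_deriv_right_le (f' := y) (δ := 0) (K := B) (ε := A)
    (fun x hx => (hG x hx).continuousAt.continuousWithinAt)
    (fun x hx _ hρ =>
      (hG x (Set.Ico_subset_Icc_self hx)).hasDerivWithinAt.liminf_right_slope_le hρ)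
    (by simp) (fun x hx => by linarith [h x (Set.Ico_subset_Icc_self hx)]) t
    (Set.right_mem_Icc.2 hst)
  refine (h t (Set.right_mem_Icc.2 hst)).trans ?_
  gcongr

/-! ### Truncating weights -/

/-- A weighted `ℓ²` norm is bounded by the limit of bounds on truncated sums with weights that
converge pointwise. -/
theorem sob_sq_le_of_tendsto {s : ℝ} {c : ℤ → ℂ} {w : ℕ → ℤ → ℝ} {S : ℕ → Finset ℤ}
    (hS : ∀ n, ∀ k ∉ S n, w n k = 0)
    (hw : ∀ k, Tendsto (fun n => w n k) atTop (𝓝 (weight (s / 2) k)))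
    {b : ℕ → ℝ} {b' : ℝ} (hb : Tendsto b atTop (𝓝 b'))
    (h : ∀ᶠ n in atTop, ∑ k ∈ S n, w n k ^ 2 * ‖c k‖ ^ 2 ≤ b n) : sob s c ^ 2 ≤ b' := by
  rw [sob_sq]
  refine Real.tsum_le_of_sum_le (weight_mul_sq_nonneg s c) fun T => ?_
  have h1 : Tendsto (fun n => ∑ k ∈ T, w n k ^ 2 * ‖c k‖ ^ 2) atTop
      (𝓝 (∑ k ∈ T, weight s k * ‖c k‖ ^ 2)) := by
    refine tendsto_finsetSum _ fun k _ => ?_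
    rw [← weight_half_sq]
    exact ((hw k).pow 2).mul_const _
  refine le_of_tendsto_of_tendsto h1 hb (h.mono fun n hn => ?_)
  have h2 : ∑ k ∈ S n ∪ T, w n k ^ 2 * ‖c k‖ ^ 2 = ∑ k ∈ S n, w n k ^ 2 * ‖c k‖ ^ 2 :=
    (Finset.sum_subset Finset.subset_union_left fun k _ hk => by simp [hS n k hk]).symm
  refine le_trans ?_ hn
  rw [← h2]
  exact Finset.sum_le_sum_of_subset_of_nonneg Finset.subset_union_right fun _ _ _ => by positivity

/-- The tent function with support in `[-n, n]`. -/
noncomputable def tent (n : ℕ) (k : ℤ) : ℝ := max 0 (1 - |(k : ℝ)| / n)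

theorem abs_tent_sub_le {n : ℕ} (hn : 0 < n) (k j : ℤ) :
    |tent n k - tent n j| ≤ |((k - j : ℤ) : ℝ)| / n := by
  have hn' : (0 : ℝ) < n := by exact_mod_cast hn
  have h : |tent n k - tent n j| ≤ |(1 - |(k : ℝ)| / n) - (1 - |(j : ℝ)| / n)| :=
    (abs_max_sub_max_le_max (0 : ℝ) (1 - |(k : ℝ)| / n) 0 (1 - |(j : ℝ)| / n)).trans (by simp)
  refine h.trans ?_
  rw [sub_sub_sub_cancel_left, ← sub_div, abs_div, abs_of_pos hn']
  refine div_le_div_of_nonneg_right ?_ hn'.le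
  rw [abs_sub_comm]
  push_cast
  exact abs_abs_sub_abs_le_abs_sub _ _

theorem tent_eq_zero {n : ℕ} (hn : 0 < n) {k : ℤ} (hk : k ∉ Finset.Icc (-(n : ℤ)) n) :
    tent n k = 0 := by
  have hn' : (0 : ℝ) < n := by exact_mod_cast hn
  rw [Finset.mem_Icc, ← abs_le, not_le] at hk
  have h1 : (n : ℝ) < |(k : ℝ)| := by exact_mod_cast hk
  refine max_eq_left ?_
  rw [sub_nonpos, le_div_iff₀ hn']
  linarith

theorem tendsto_tent (k : ℤ) : Tendsto (fun n => tent n k) atTop (𝓝 1) := by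
  have h1 : Tendsto (fun n : ℕ => |(k : ℝ)| / n) atTop (𝓝 0) :=
    tendsto_const_div_atTop_nhds_zero_nat _
  have h2 := (tendsto_const_nhds (x := (0 : ℝ))).max ((tendsto_const_nhds (x := (1 : ℝ))).sub h1)
  simpa [tent] using h2

/-- The weight `(1 + k²)^(σ/2)` for low frequencies, folded down to zero for high ones. Since this
is a `1`-Lipschitz function of `(1 + k²)^(σ/2)`, commutators are bounded uniformly in `n`. -/
noncomputable def foldWeight (σ : ℝ) (n : ℕ) (k : ℤ) : ℝ :=
  max 0 (min (weight (σ / 2) k) (n - weight (σ / 2) k))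

theorem abs_foldWeight_sub_le (σ : ℝ) (n : ℕ) (k j : ℤ) :
    |foldWeight σ n k - foldWeight σ n j| ≤ |weight (σ / 2) k - weight (σ / 2) j| := by
  set x := weight (σ / 2) k with hx
  set y := weight (σ / 2) j with hy
  have h1 : |foldWeight σ n k - foldWeight σ n j| ≤ |min x (n - x) - min y (n - y)| :=
    (abs_max_sub_max_le_max (0 : ℝ) (min x (n - x)) 0 (min y (n - y))).trans (by simp)
  refine h1.trans ((abs_min_sub_min_le_max _ _ _ _).trans ?_)
  rw [sub_sub_sub_cancel_left, abs_sub_comm y x, max_self]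

theorem foldWeight_eq_zero {σ : ℝ} (hσ : 1 ≤ σ) {n : ℕ} {k : ℤ}
    (hk : k ∉ Finset.Icc (-(n : ℤ)) n) : foldWeight σ n k = 0 := by
  rw [Finset.mem_Icc, ← abs_le, not_le] at hk
  have h1 : (n : ℝ) < |(k : ℝ)| := by exact_mod_cast hk
  have h2 : weight (1 / 2) k ≤ weight (σ / 2) k := weight_mono (by linarith) k
  have h3 := abs_le_weight k
  refine max_eq_left ((min_le_right _ _).trans ?_)
  linarith

theorem tendsto_foldWeight (σ : ℝ) (k : ℤ) :
    Tendsto (fun n => foldWeight σ n k) atTop (𝓝 (weight (σ / 2) k)) := by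
  refine tendsto_const_nhds.congr' ?_
  filter_upwards [(tendsto_natCast_atTop_atTop (R := ℝ)).eventually_ge_atTop
    (2 * weight (σ / 2) k)] with n hn
  have := (weight_pos (σ / 2) k).le
  rw [foldWeight, min_eq_left (by linarith), max_eq_right this]

/-! ### Bounds for solutions -/

section Bounds

variable {r q : ℝ} {a : ℤ → ℝ}

/-- `A` maps `H^q` to `H^(q-r)`, which is contained in `L²`. -/
theorem sob_momentum_le (ha : IsInertiaSymbol r a) (hq : r + 1 ≤ q) :
    ∃ C, 0 ≤ C ∧ ∀ f : SobolevSpace q, MemSob (q - r) (momentum a (toL2 q f)) ∧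
      sob (q - r) (momentum a (toL2 q f)) ≤ C * ‖f‖ ∧
      MemSob 0 (momentum a (toL2 q f)) ∧ sob 0 (momentum a (toL2 q f)) ≤ C * ‖f‖ := by
  obtain ⟨C, hC⟩ := ha.order
  refine ⟨|C|, abs_nonneg _, fun f => ?_⟩
  have hU : MemSob q (fhat (toL2 q f)) := f.summable
  have h := MemSob.multiplier (s := q - r) (momentum_bound hC (toL2 q f))
    (by rwa [sub_add_cancel])
  rw [sub_add_cancel, ← norm_eq_sob] at h
  have h0 := h.1.of_le (show 0 ≤ q - r by linarith)
  exact ⟨h.1, h.2, h0.1, h0.2.trans h.2⟩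

/-- `A⁻¹` maps `H^(q-r)` to `H^q`. -/
theorem norm_le_sob_momentum (ha : IsInertiaSymbol r a) (hq : r + 1 ≤ q) :
    ∃ C, 0 ≤ C ∧ ∀ f : SobolevSpace q, ‖f‖ ≤ C * sob (q - r) (momentum a (toL2 q f)) := by
  obtain ⟨C, hC⟩ := ha.inv_order
  obtain ⟨Ca, -, hCa⟩ := sob_momentum_le ha hq
  refine ⟨|C|, abs_nonneg _, fun f => ?_⟩
  have h := MemSob.multiplier (s := q) (fhat_bound_momentum ha.ne_zero hC (toL2 q f))
    (by rw [← sub_eq_add_neg]; exact (hCa f).1)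
  rw [← sub_eq_add_neg] at h
  rw [norm_eq_sob]
  exact h.2

/-- The `L²` norm of the momentum grows at most exponentially: formally,
`d/dt ∫ (Au)² = -3 ∫ u_x (Au)²`. -/
theorem IsEulerSolution.sob_zero_momentum_le (hr : 2 ≤ r) (hq : r + 1 ≤ q)
    (ha : IsInertiaSymbol r a) {J : Set ℝ} (hJ : IsOpen J) {u : ℝ → SobolevSpace q}
    (hu : IsEulerSolution a q J u) {c s t : ℝ}
    (hst : s ≤ t) (hsub : Set.Icc s t ⊆ J)
    (hc : ∀ τ ∈ Set.Icc s t, ∀ᵐ x ∂(AddCircle.haarAddCircle (T := 2 * π)),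
      c ≤ D (toL2 q (u τ)) x) :
    sob 0 (momentum a (toL2 q (u t))) ^ 2 ≤
      sob 0 (momentum a (toL2 q (u s))) ^ 2 * Real.exp (3 * |c| * (t - s)) := by
  obtain ⟨K, hK0, hK⟩ := exists_energy_deriv_le hr hq ha
  obtain ⟨C, hC0, hC⟩ := sob_momentum_le ha hq
  obtain ⟨Y, hY⟩ := (isCompact_Icc (a := s) (b := t)).exists_bound_of_continuousOn
    (hu.continuousOn.mono hsub)
  have hY0 : 0 ≤ Y := (norm_nonneg _).trans (hY s (Set.left_mem_Icc.2 hst))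
  -- The weight `tent n` is `1 / n`-Lipschitz, so the commutator disappears as `n → ∞`.
  set ε : ℕ → ℝ := fun n => 2 / n * (K * (C * Y) * Y ^ 2) with hε
  have hε0 : Tendsto ε atTop (𝓝 0) := by
    have h := (tendsto_const_div_atTop_nhds_zero_nat (2 : ℝ)).mul_const (K * (C * Y) * Y ^ 2)
    rwa [zero_mul] at h
  have hlim := ((gronwallBound_continuous_ε (sob 0 (momentum a (toL2 q (u s))) ^ 2)
    (3 * |c|) (t - s)).tendsto 0).comp hε0
  rw [gronwallBound_ε0] at hlim
  have hw1 : ∀ n k, tent n k ≤ 1 := fun n k =>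
    max_le zero_le_one (sub_le_self _ (by positivity))
  refine sob_sq_le_of_tendsto (w := fun n => tent (n + 1))
    (S := fun n => Finset.Icc (-((n + 1 : ℕ) : ℤ)) ((n + 1 : ℕ) : ℤ))
    (fun n k hk => tent_eq_zero n.succ_pos hk) (fun k => ?_)
    (hlim.comp (tendsto_add_atTop_nat 1)) (.of_forall fun n => ?_)
  · rw [zero_div, weight_zero]
    exact (tendsto_tent k).comp (tendsto_add_atTop_nat 1)
  set w := tent (n + 1)
  set S := Finset.Icc (-((n + 1 : ℕ) : ℤ)) ((n + 1 : ℕ) : ℤ)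
  have hn' : (0 : ℝ) < ((n + 1 : ℕ) : ℝ) := by exact_mod_cast n.succ_pos
  have hσ : 1 ≤ q - r := by linarith
  have key : ∀ τ ∈ Set.Icc s t, DifferentiableAt ℝ (fun τ => energy a w S (toL2 q (u τ))) τ ∧
      deriv (fun τ => energy a w S (toL2 q (u τ))) τ ≤
        3 * |c| * energy a w S (toL2 q (u τ)) + ε (n + 1) := by
    intro τ hτ
    have h := hK hJ hu (hsub hτ) (hc τ hτ) (w := w) (S := S) (B := 2 / ((n + 1 : ℕ) : ℝ))
      (fun k hk => tent_eq_zero n.succ_pos hk) (fun k => le_max_left _ _)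
      (fun k => (hw1 _ k).trans (one_le_weight (by linarith) k)) (by positivity) (fun k j => by
        have h1 := abs_tent_sub_le n.succ_pos k j
        have h2 := abs_le_weight (k - j)
        have h3 := abs_two_mul_sub_le k j
        have h4 : weight (1 / 2) j ≤ weight ((q - r) / 2) j := weight_mono (by linarith) j
        have h6 : weight (1 / 2) (k - j) * weight (1 / 2) (k - j) ≤
            weight ((q - r + 1) / 2) (k - j) := by
          rw [weight_mul_weight]; exact weight_mono (by linarith) _
        have hd := weight_pos (1 / 2) (k - j)
        have hj := weight_pos (1 / 2) j
        calc |tent (n + 1) k - tent (n + 1) j| * |((2 * k - j : ℤ) : ℝ)|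
            ≤ (weight (1 / 2) (k - j) / ((n + 1 : ℕ) : ℝ)) *
              (2 * weight (1 / 2) (k - j) + weight (1 / 2) j) := by
              gcongr
              exact h1.trans (by gcongr)
          _ = 2 / ((n + 1 : ℕ) : ℝ) * (weight (1 / 2) (k - j) * (weight (1 / 2) j / 2) +
              weight (1 / 2) (k - j) * weight (1 / 2) (k - j)) := by field_simp; ring
          _ ≤ _ := by
              gcongr
              linarith)
    refine ⟨h.1, h.2.trans (add_le_add_right ?_ _)⟩
    have h1 := (hC (u τ)).2.2.2
    have h2 := hY τ hτ
    have h3 := sob_nonneg 0 (momentum a (toL2 q (u τ)))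
    have h4 : sob 0 (momentum a (toL2 q (u τ))) ≤ C * Y := h1.trans (by gcongr)
    calc _ ≤ 2 / ((n + 1 : ℕ) : ℝ) * K * (C * Y) * Y ^ 2 := by gcongr
      _ = ε (n + 1) := by rw [hε]; ring
  have h := le_gronwallBound_of_liminf_deriv_right_le
    (f' := deriv fun τ => energy a w S (toL2 q (u τ)))
    (δ := sob 0 (momentum a (toL2 q (u s))) ^ 2) (K := 3 * |c|) (ε := ε (n + 1))
    (fun τ hτ => (key τ hτ).1.continuousAt.continuousWithinAt)
    (fun τ hτ _ hρ =>
      (key τ (Set.Ico_subset_Icc_self hτ)).1.hasDerivAt.hasDerivWithinAt.liminf_right_slope_le hρ)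
    (energy_le_sob S (fun k => le_max_left _ _) (fun k => by
      rw [zero_div, weight_zero]; exact hw1 _ k) (hC (u s)).2.2.1)
    (fun τ hτ => (key τ (Set.Ico_subset_Icc_self hτ)).2) t (Set.right_mem_Icc.2 hst)
  exact h

/-- As long as `u_x ≥ c` and the `L²` norm of the momentum is at most `Z`, the square of the `H^q`
norm satisfies a linear integral inequality. -/
theorem exists_norm_sq_le_integral (hr : 2 ≤ r) (hq : r + 1 ≤ q)
    (ha : IsInertiaSymbol r a) (c Z : ℝ) :
    ∃ A B, 0 ≤ A ∧ 0 ≤ B ∧ ∀ {J : Set ℝ}, IsOpen J → ∀ {u : ℝ → SobolevSpace q},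
      IsEulerSolution a q J u → ∀ {s t : ℝ}, s ≤ t → Set.Icc s t ⊆ J →
      (∀ τ ∈ Set.Icc s t, ∀ᵐ x ∂(AddCircle.haarAddCircle (T := 2 * π)),
        c ≤ D (toL2 q (u τ)) x) →
      (∀ τ ∈ Set.Icc s t, sob 0 (momentum a (toL2 q (u τ))) ≤ Z) →
      ‖u t‖ ^ 2 ≤ A * ‖u s‖ ^ 2 + B * ∫ τ in s..t, ‖u τ‖ ^ 2 := by
  obtain ⟨K, hK0, hK⟩ := exists_energy_deriv_le hr hq ha
  obtain ⟨C, hC0, hC⟩ := sob_momentum_le ha hq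
  obtain ⟨C', hC'0, hC'⟩ := norm_le_sob_momentum ha hq
  set B₀ : ℝ := 2 * (q - r) * 2 ^ (q - r) with hB₀
  have hσ : 1 ≤ q - r := by linarith
  have hB₀0 : 0 ≤ B₀ := by positivity
  set B₁ : ℝ := 3 * |c| * C ^ 2 + B₀ * K * |Z| with hB₁
  refine ⟨C' ^ 2 * C ^ 2, C' ^ 2 * B₁, by positivity, by positivity, ?_⟩
  intro J hJ u hu s t hst hsub hc hZ
  have hy : ContinuousOn (fun τ => ‖u τ‖ ^ 2) J := (hu.continuousOn.norm).pow 2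
  have hG : ∀ τ ∈ Set.Icc s t, HasDerivAt (fun x => ∫ τ in s..x, ‖u τ‖ ^ 2) (‖u τ‖ ^ 2) τ :=
    fun τ hτ => hasDerivAt_integral hJ hy hsub hτ
  have hmain : sob (q - r) (momentum a (toL2 q (u t))) ^ 2 ≤
      C ^ 2 * ‖u s‖ ^ 2 + B₁ * ∫ τ in s..t, ‖u τ‖ ^ 2 := by
    refine sob_sq_le_of_tendsto (w := fun n => foldWeight (q - r) n)
      (S := fun n => Finset.Icc (-(n : ℤ)) n) (fun n k hk => foldWeight_eq_zero hσ hk)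
      (tendsto_foldWeight (q - r)) tendsto_const_nhds (.of_forall fun n => ?_)
    set w := foldWeight (q - r) n
    set S := Finset.Icc (-(n : ℤ)) n
    have hw0 : ∀ k, 0 ≤ w k := fun k => le_max_left _ _
    have hw : ∀ k, w k ≤ weight ((q - r) / 2) k := fun k =>
      max_le (weight_pos _ _).le (min_le_left _ _)
    have hE : ∀ τ, energy a w S (toL2 q (u τ)) ≤ C ^ 2 * ‖u τ‖ ^ 2 := by
      intro τ
      refine (energy_le_sob S hw0 hw (hC (u τ)).1).trans ?_
      rw [← mul_pow]
      exact pow_le_pow_left₀ (sob_nonneg _ _) (hC (u τ)).2.1 2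
    have key : ∀ τ ∈ Set.Icc s t, DifferentiableAt ℝ (fun τ => energy a w S (toL2 q (u τ))) τ ∧
        deriv (fun τ => energy a w S (toL2 q (u τ))) τ ≤ B₁ * ‖u τ‖ ^ 2 := by
      intro τ hτ
      have h := hK hJ hu (hsub hτ) (hc τ hτ) (w := w) (S := S) (B := B₀)
        (fun k hk => foldWeight_eq_zero hσ hk) hw0 hw hB₀0 (fun k j =>
          (mul_le_mul_of_nonneg_right (abs_foldWeight_sub_le _ _ _ _) (abs_nonneg _)).trans
            (commutator_weight hσ k j))
      refine ⟨h.1, h.2.trans ?_⟩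
      have h1 := hE τ
      have h2 := (hZ τ hτ).trans (le_abs_self Z)
      calc _ ≤ 3 * |c| * (C ^ 2 * ‖u τ‖ ^ 2) + B₀ * K * |Z| * ‖u τ‖ ^ 2 := by gcongr
        _ = _ := by rw [hB₁]; ring
    refine image_le_of_deriv_right_le_deriv_boundary
      (f := fun τ => energy a w S (toL2 q (u τ)))
      (f' := deriv fun τ => energy a w S (toL2 q (u τ)))
      (B := fun x => C ^ 2 * ‖u s‖ ^ 2 + B₁ * ∫ τ in s..x, ‖u τ‖ ^ 2)
      (B' := fun x => B₁ * ‖u x‖ ^ 2)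
      (fun τ hτ => (key τ hτ).1.continuousAt.continuousWithinAt)
      (fun τ hτ => (key τ (Set.Ico_subset_Icc_self hτ)).1.hasDerivAt.hasDerivWithinAt)
      ?_ (fun τ hτ => (((hG τ hτ).const_mul B₁).const_add _).continuousAt.continuousWithinAt)
      (fun τ hτ => (((hG τ (Set.Ico_subset_Icc_self hτ)).const_mul B₁).const_add
        _).hasDerivWithinAt)
      (fun τ hτ => (key τ (Set.Ico_subset_Icc_self hτ)).2) (Set.right_mem_Icc.2 hst)
    simpa using hE s
  calc ‖u t‖ ^ 2 ≤ (C' * sob (q - r) (momentum a (toL2 q (u t)))) ^ 2 :=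
        pow_le_pow_left₀ (norm_nonneg _) (hC' (u t)) 2
    _ = C' ^ 2 * sob (q - r) (momentum a (toL2 q (u t))) ^ 2 := mul_pow _ _ _
    _ ≤ C' ^ 2 * (C ^ 2 * ‖u s‖ ^ 2 + B₁ * ∫ τ in s..t, ‖u τ‖ ^ 2) := by gcongr
    _ = _ := by ring

end Bounds

end EulerCircle

theorem theorem5p2 (r q : ℝ) (hr : 2 ≤ r) (hq : r + 1 ≤ q)
    (a : ℤ → ℝ) (ha : EulerCircle.IsInertiaSymbol r a)
    (J : Set ℝ) (hJopen : IsOpen J) (hJ : J.OrdConnected)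
    (u : ℝ → EulerCircle.SobolevSpace q) (hu : EulerCircle.IsEulerSolution a q J u)
    (I : Set ℝ) (hIJ : I ⊆ J) (hI : I.OrdConnected) (hIbdd : Bornology.IsBounded I)
    (hIleft : ∃ t₀ ∈ J, ∀ t ∈ I, t₀ ≤ t)
    (hinf : ∃ c : ℝ, ∀ t ∈ I, ∀ᵐ x ∂(AddCircle.haarAddCircle (T := 2 * Real.pi)),
      c ≤ EulerCircle.D (EulerCircle.SobolevSpace.toL2 q (u t)) x) :
    ∃ M : ℝ, ∀ t ∈ I, ‖u t‖ ≤ M := by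
  obtain ⟨t₀, ht₀, hI0⟩ := hIleft
  obtain ⟨c, hc⟩ := hinf
  rcases I.eq_empty_or_nonempty with rfl | ⟨s, hs⟩
  · exact ⟨0, fun t ht => ht.elim⟩
  -- The lower bound on `u_x` is known on `I` only; before `s ∈ I`, compactness suffices.
  obtain ⟨M₁, hM₁⟩ := (isCompact_Icc (a := t₀) (b := s)).exists_bound_of_continuousOn
    (hu.continuousOn.mono (hJ.out ht₀ (hIJ hs)))
  obtain ⟨T, hT⟩ := hIbdd.bddAbove
  set z₀ := EulerCircle.sob 0 (EulerCircle.momentum a (EulerCircle.SobolevSpace.toL2 q (u s)))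
  obtain ⟨A, B, hA, hB, hAB⟩ := EulerCircle.exists_norm_sq_le_integral hr hq ha c
    √(z₀ ^ 2 * Real.exp (3 * |c| * (T - s)))
  have hsT : s ≤ T := hT hs
  have hA' : 0 ≤ A * ‖u s‖ ^ 2 := by positivity
  set Y := A * ‖u s‖ ^ 2 + B * gronwallBound 0 B (A * ‖u s‖ ^ 2) (T - s) with hY
  refine ⟨max M₁ √Y, fun t ht => ?_⟩
  rcases le_total t s with hts | hst
  · exact le_max_of_le_left (hM₁ t ⟨hI0 t ht, hts⟩)
  refine le_max_of_le_right (Real.le_sqrt_of_sq_le ?_)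
  have hsub : Set.Icc s t ⊆ I := hI.out hs ht
  have htT : t ≤ T := hT ht
  have hz : ∀ τ ∈ Set.Icc s t,
      EulerCircle.sob 0 (EulerCircle.momentum a (EulerCircle.SobolevSpace.toL2 q (u τ))) ≤
        √(z₀ ^ 2 * Real.exp (3 * |c| * (T - s))) := by
    intro τ hτ
    have hτs : Set.Icc s τ ⊆ I := (Set.Icc_subset_Icc_right hτ.2).trans hsub
    refine Real.le_sqrt_of_sq_le ((hu.sob_zero_momentum_le hr hq ha hJopen hτ.1
      (hτs.trans hIJ) fun x hx => hc x (hτs hx)).trans ?_)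
    have : τ ≤ T := hτ.2.trans htT
    gcongr
  refine (EulerCircle.le_of_le_add_integral (y := fun τ => ‖u τ‖ ^ 2)
    (A := A * ‖u s‖ ^ 2) hJopen ((hu.continuousOn.norm).pow 2) hB hst
    (hsub.trans hIJ) fun x hx => ?_).trans ?_
  · have hx' : Set.Icc s x ⊆ Set.Icc s t := Set.Icc_subset_Icc_right hx.2
    exact hAB hJopen hu hx.1 ((hx'.trans hsub).trans hIJ) (fun τ hτ => hc τ (hsub (hx' hτ)))
      fun τ hτ => hz τ (hx' hτ)
  · rw [hY]
    gcongr
    exact gronwallBound_mono le_rfl hA' hB (by linarith)
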